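/- Let $K$ be a field, $S=K[X_1,X_2,X_3,X_4]$ with its standard $\mathbb{Z}^4$-grading, $\mathfrak m=(X_1,X_2,X_3,X_4)$, and let $I=(X_1X_3,X_1X_4,X_2X_4)$. Then $I$ is the Stanley--Reisner ideal of the $4$-pointed path (the simplicial complex on $\{1,2,3,4\}$ with facets $\{1,2\},\{2,3\},\{3,4\}$), that is, $I$ is generated by the squarefree monomials $\prod_{i\in F}X_i$ with $F$ not a face. Moreover: (1) $S/I^2$ is Buchsbaum, i.e. for all $i<\dim S/I^2$ the canonical map $H^i(\mathfrak m;S/I^2)\to H^i_{\mathfrak m}(S/I^2)=\varinjlim_N \operatorname{Ext}^i_S(S/\mathfrak m^N,S/I^2)$ from Koszul cohomology with respect to $X_1,\dots,X_4$ to local cohomology is surjective; (2) $S/I^2$ is not Cohen--Macaulay; (3) the Krull dimension of $S/I^2$ is $2$ and its depth with respect to $\mathfrak m$ is $1$; (4) $H^1_{\mathfrak m}(S/I^2)\cong S/\mathfrak m\cong K$ as $S$-modules, in particular $\dim_K H^1_{\mathfrak m}(S/I^2)=1$, and in the natural $\mathbb{Z}^4$-grading $H^1_{\mathfrak m}(S/I^2)$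 is concentrated in degree $(1,0,0,1)$ (the degree of $t_1t_4$): its component of degree $(1,0,0,1)$ is everything and all its other components vanish. -/

import Mathlib

open CategoryTheory Opposite

universe u

noncomputable section

/-! ### Depth and Cohen–Macaulay rings -/

/-- The depth of `M` with respect to the ideal `I`: the supremum of the lengths of the
`M`-regular sequences consisting of elements of `I`. -/
def moduleDepth {R : Type*} [CommRing R] (I : Ideal R) (M : Type*) [AddCommGroup M] [Module R M] :
    ℕ∞ :=
  ⨆ (rs : List R) (_ : (∀ r ∈ rs, r ∈ I) ∧ RingTheory.Sequence.IsRegular M rs), (rs.length : ℕ∞)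

/-- A Noetherian ring is Cohen–Macaulay if all its localizations `R_p` at prime ideals satisfy
`depth R_p = dim R_p`. -/
def IsCohenMacaulayRing (R : Type*) [CommRing R] : Prop :=
  IsNoetherianRing R ∧ ∀ (p : Ideal R) [p.IsPrime],
    ((moduleDepth (IsLocalRing.maximalIdeal (Localization.AtPrime p)) (Localization.AtPrime p) :
      ℕ∞) : WithBot ℕ∞) = ringKrullDim (Localization.AtPrime p)

/-! ### Stanley–Reisner ideals and paths -/

/-- The Stanley–Reisner ideal: generated by the squarefree monomials whose support is not a face.
(The faces of Mathlib's simplicial complexes are nonempty by convention, so the empty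
set, which counts as a face, has to be excluded here.) -/
def stanleyReisnerIdeal (K : Type*) [Field K] {n : ℕ} (Δ : AbstractSimplicialComplex (Fin n)) :
    Ideal (MvPolynomial (Fin n) K) :=
  Ideal.span {p | ∃ F : Finset (Fin n), F.Nonempty ∧ F ∉ Δ ∧ p = ∏ i ∈ F, MvPolynomial.X i}

/-- The `n`-pointed path: the simplicial complex on `n` vertices in a row whose faces are
the vertices and the pairs of consecutive vertices. -/
def pathComplex (n : ℕ) : AbstractSimplicialComplex (Fin n) where
  faces := {F | F.Nonempty ∧ ∃ i : ℕ, ∀ v ∈ F, (v : ℕ) = i ∨ (v : ℕ) = i + 1}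
  isRelLowerSet_faces := by
    rintro F ⟨hF, i, hi⟩
    exact ⟨hF, fun G hG hne => ⟨hne, i, fun v hv => hi v (hG hv)⟩⟩
  singleton_mem v := ⟨Finset.singleton_nonempty v, v, by simp⟩

/-! ### The Koszul complex -/

section Koszul

variable {R : Type u} [CommRing R] {n : ℕ}

/-- The sign `(-1) ^ #{k ∈ s | k < j}`. -/
def koszulSign (R : Type u) [CommRing R] {n : ℕ} (j : Fin n) (s : Finset (Fin n)) : R :=
  (-1) ^ (s.filter (· < j)).card

/-- The Koszul differential on the free module with basis `e_s`, `s ⊆ {0, …, n - 1}`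
(think of `e_s` as the exterior product of the `e_j`, `j ∈ s`):
`e_s ↦ ∑_{j ∈ s} (-1) ^ #{k ∈ s | k < j} x_j e_{s \ j}`. -/
def koszulD (x : Fin n → R) : (Finset (Fin n) →₀ R) →ₗ[R] (Finset (Fin n) →₀ R) :=
  Finsupp.linearCombination R fun s =>
    ∑ j ∈ s, Finsupp.single (s.erase j) (koszulSign R j s * x j)

lemma koszulD_single (x : Fin n → R) (s : Finset (Fin n)) (r : R) :
    koszulD x (Finsupp.single s r) =
      ∑ j ∈ s, Finsupp.single (s.erase j) (koszulSign R j s * x j * r) := by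
  rw [koszulD, Finsupp.linearCombination_single, Finset.smul_sum]
  exact Finset.sum_congr rfl fun j _ => by rw [Finsupp.smul_single, smul_eq_mul, mul_comm]

lemma koszulSign_mul_erase {j k : Fin n} (h : j < k) {s : Finset (Fin n)} (hj : j ∈ s) :
    koszulSign R k s = - koszulSign R k (s.erase j) := by
  unfold koszulSign
  rw [Finset.filter_erase]
  have hm : j ∈ s.filter (· < k) := by simp [hj, h]
  rw [← Finset.card_erase_add_one hm, pow_succ]
  ring

lemma koszulSign_erase_of_lt {j k : Fin n} (h : j < k) (s : Finset (Fin n)) :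
    koszulSign R j (s.erase k) = koszulSign R j s := by
  unfold koszulSign
  rw [Finset.filter_erase, Finset.erase_eq_of_notMem]
  simp [h.le]

lemma koszulSign_swap {j k : Fin n} (h : j ≠ k) {s : Finset (Fin n)} (hj : j ∈ s) (hk : k ∈ s) :
    koszulSign R j s * koszulSign R k (s.erase j) =
      - (koszulSign R k s * koszulSign R j (s.erase k)) := by
  rcases lt_or_gt_of_ne h with h | h
  · rw [koszulSign_mul_erase h hj, koszulSign_erase_of_lt h]; ring
  · rw [koszulSign_mul_erase h hk, koszulSign_erase_of_lt h]; ring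

lemma koszulD_comp (x : Fin n → R) : koszulD x ∘ₗ koszulD x = 0 := by
  ext1 s
  ext1
  simp only [LinearMap.comp_apply, Finsupp.lsingle_apply, koszulD_single, map_sum,
    LinearMap.zero_apply]
  rw [Finset.sum_sigma']
  refine Finset.sum_involution (fun p _ => ⟨p.2, p.1⟩) ?_ ?_ ?_ ?_
  · rintro ⟨j, k⟩ hp
    simp only [Finset.mem_sigma, Finset.mem_erase] at hp
    obtain ⟨hj, hkj, hk⟩ := hp
    dsimp only
    rw [Finset.erase_right_comm, ← Finsupp.single_add]
    have := koszulSign_swap (R := R) (Ne.symm hkj) hj hk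
    rw [Finsupp.single_eq_zero]
    linear_combination (x j * x k) * this
  · rintro ⟨j, k⟩ hp _ h
    simp only [Finset.mem_sigma, Finset.mem_erase] at hp
    simp only [Sigma.mk.injEq] at h
    exact hp.2.1 h.1
  · rintro ⟨j, k⟩ hp
    simp only [Finset.mem_sigma, Finset.mem_erase] at hp ⊢
    exact ⟨hp.2.2, Ne.symm hp.2.1, hp.1⟩
  · rintro ⟨j, k⟩ hp
    rfl

/-- The `i`-th term of the Koszul complex: the free module on the `e_s` with `#s = i`. -/
def koszulX (R : Type u) [CommRing R] (n i : ℕ) : Submodule R (Finset (Fin n) →₀ R) :=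
  Finsupp.supported R R {s | s.card = i}

/-- The basis vector `e_s`. -/
def koszulBasis (R : Type u) [CommRing R] {n i : ℕ} (s : Finset (Fin n)) (hs : s.card = i) :
    koszulX R n i :=
  ⟨Finsupp.single s 1, Finsupp.single_mem_supported R 1 hs⟩

lemma koszulX_le {M : Type*} [AddCommGroup M] [Module R M] {i : ℕ}
    (f : (Finset (Fin n) →₀ R) →+ M) (N : AddSubgroup M)
    (h : ∀ s : Finset (Fin n), s.card = i → ∀ r : R, f (Finsupp.single s r) ∈ N)
    {z : Finset (Fin n) →₀ R} (hz : z ∈ koszulX R n i) : f z ∈ N := by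
  rw [← Finsupp.sum_single z, Finsupp.sum, map_sum]
  exact sum_mem fun s hs => h s (hz hs) _

lemma koszulD_mem (x : Fin n → R) {i : ℕ} {z : Finset (Fin n) →₀ R}
    (hz : z ∈ koszulX R n (i + 1)) : koszulD x z ∈ koszulX R n i := by
  refine koszulX_le (koszulD x).toAddMonoidHom (koszulX R n i).toAddSubgroup ?_ hz
  intro s hs r
  simp only [LinearMap.toAddMonoidHom_coe, koszulD_single, Submodule.mem_toAddSubgroup]
  refine sum_mem fun j hj => Finsupp.single_mem_supported R _ ?_
  simp [Finset.card_erase_of_mem hj, hs]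

/-- The Koszul complex `K_•(x; R)`. -/
def koszulComplex (x : Fin n → R) : ChainComplex (ModuleCat.{u} R) ℕ :=
  ChainComplex.of (fun i => ModuleCat.of R (koszulX R n i))
    (fun i => ModuleCat.ofHom ((koszulD x).restrict fun _ hz => koszulD_mem (i := i) x hz))
    (fun i => by
      refine ModuleCat.hom_ext (LinearMap.ext fun z => Subtype.ext ?_)
      exact DFunLike.congr_fun (koszulD_comp x) z.1)

/-- The Koszul cochain complex `Hom(K_•(x; R), M)`. -/
abbrev koszulCochains (x : Fin n → R) (M : ModuleCat.{u} R) : CochainComplex (ModuleCat.{u} R) ℕ :=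
  (koszulComplex x).linearYonedaObj R M

/-- The `i`-th Koszul cohomology module `H^i(x; M)`. -/
abbrev koszulCohomology (x : Fin n → R) (i : ℕ) (M : ModuleCat.{u} R) : ModuleCat.{u} R :=
  (koszulCochains x M).homology i

end Koszul

section Resolution

open MvPolynomial

variable {K : Type u} [Field K] {n : ℕ}

/-- The powers `X_1^t, …, X_n^t` of the variables. -/
def varPow (K : Type u) [Field K] (n t : ℕ) : Fin n → MvPolynomial (Fin n) K := fun j => X j ^ t

/-- The ideal `(X_1^t, …, X_n^t)`. -/
def varPowIdeal (K : Type u) [Field K] (n t : ℕ) : Ideal (MvPolynomial (Fin n) K) :=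
  Ideal.span (Set.range (varPow K n t))

/-- The `K`-basis `X^a e_s` of the Koszul complex. -/
def koszulMonomialBasis (K : Type u) [Field K] (n : ℕ) :
    Module.Basis (Σ _ : Finset (Fin n), Fin n →₀ ℕ) K (Finset (Fin n) →₀ MvPolynomial (Fin n) K) :=
  Finsupp.basis fun _ => basisMonomials (Fin n) K

/-- The indices `j` with `j ∈ s` or `t ≤ a_j`. -/
def koszulActive (t : ℕ) (s : Finset (Fin n)) (a : Fin n →₀ ℕ) : Finset (Fin n) :=
  s ∪ Finset.univ.filter fun j => t ≤ a j

/-- A contracting homotopy for the Koszul complex of `X_1^t, …, X_n^t`. -/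
def koszulH (K : Type u) [Field K] (n t : ℕ) :
    (Finset (Fin n) →₀ MvPolynomial (Fin n) K) →ₗ[K] (Finset (Fin n) →₀ MvPolynomial (Fin n) K) :=
  (koszulMonomialBasis K n).constr K fun p =>
    if h : (koszulActive t p.1 p.2).Nonempty then
      let j := (koszulActive t p.1 p.2).min' h
      if j ∈ p.1 then 0
      else Finsupp.single (insert j p.1) (monomial (p.2 - Finsupp.single j t) 1)
    else 0

lemma koszulH_single (t : ℕ) (s : Finset (Fin n)) (a : Fin n →₀ ℕ) :
    koszulH K n t (Finsupp.single s (monomial a 1)) =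
    if h : (koszulActive t s a).Nonempty then
      let j := (koszulActive t s a).min' h
      if j ∈ s then 0
      else Finsupp.single (insert j s) (monomial (a - Finsupp.single j t) 1)
    else 0 := by
  have : Finsupp.single s (monomial a (1 : K)) = koszulMonomialBasis K n ⟨s, a⟩ := by
    simp [koszulMonomialBasis]
  rw [this, koszulH, Module.Basis.constr_basis]

lemma koszulH_single_min (t : ℕ) (s : Finset (Fin n)) (a : Fin n →₀ ℕ) (j : Fin n)
    (hj : j ∈ koszulActive t s a) (hmin : ∀ k ∈ koszulActive t s a, j ≤ k) :
    koszulH K n t (Finsupp.single s (monomial a 1)) =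
      if j ∈ s then 0
      else Finsupp.single (insert j s) (monomial (a - Finsupp.single j t) 1) := by
  have hne : (koszulActive t s a).Nonempty := ⟨j, hj⟩
  have hm : (koszulActive t s a).min' hne = j :=
    le_antisymm (Finset.min'_le _ _ hj) (Finset.le_min' _ _ _ hmin)
  rw [koszulH_single, dif_pos hne]
  simp only [hm]

lemma koszulActive_erase (t : ℕ) (s : Finset (Fin n)) (a : Fin n →₀ ℕ) {j : Fin n} (hj : j ∈ s) :
    koszulActive t (s.erase j) (a + Finsupp.single j t) = koszulActive t s a := by
  ext k
  by_cases hk : k = j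
  · subst hk; simp [koszulActive, hj, Finsupp.single_apply]
  · simp [koszulActive, hk, Finsupp.single_apply, Ne.symm hk]

lemma koszulD_single_monomial (t : ℕ) (s : Finset (Fin n)) (a : Fin n →₀ ℕ) :
    koszulD (varPow K n t) (Finsupp.single s (monomial a 1)) =
      ∑ j ∈ s, (koszulSign K j s) •
        Finsupp.single (s.erase j) (monomial (a + Finsupp.single j t) 1) := by
  rw [koszulD_single]
  refine Finset.sum_congr rfl fun j _ => ?_
  rw [Finsupp.smul_single]
  congr 1
  have : (koszulSign (MvPolynomial (Fin n) K) j s) = C (koszulSign K j s) := by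
    simp [koszulSign]
  rw [this, varPow, X_pow_eq_monomial, smul_eq_C_mul, mul_assoc, monomial_mul, add_comm a, one_mul]

lemma koszul_homotopy_of_active (t : ℕ) (s : Finset (Fin n)) (a : Fin n →₀ ℕ)
    (hne : (koszulActive t s a).Nonempty) :
    koszulD (varPow K n t) (koszulH K n t (Finsupp.single s (monomial a 1))) +
      koszulH K n t (koszulD (varPow K n t) (Finsupp.single s (monomial a 1))) =
      Finsupp.single s (monomial a 1) := by
  obtain ⟨j, hj, hmin⟩ : ∃ j ∈ koszulActive t s a, ∀ k ∈ koszulActive t s a, j ≤ k :=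
    ⟨_, Finset.min'_mem _ hne, fun k hk => Finset.min'_le _ _ hk⟩
  have key : ∀ k ∈ s, koszulH K n t
      (Finsupp.single (s.erase k) (monomial (a + Finsupp.single k t) 1)) =
      if j ∈ s.erase k then 0 else Finsupp.single (insert j (s.erase k))
        (monomial (a + Finsupp.single k t - Finsupp.single j t) 1) := fun k hk => by
    refine koszulH_single_min t _ _ j ?_ ?_
    · rwa [koszulActive_erase t s a hk]
    · rwa [koszulActive_erase t s a hk]
  have hlt : ∀ k ∈ s, k ≠ j → j < k := fun k hk hkj =>
    lt_of_le_of_ne (hmin k (by simp [koszulActive, hk])) (Ne.symm hkj)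
  rw [koszulH_single_min t s a j hj hmin, koszulD_single_monomial, map_sum]
  simp only [map_smul]
  rw [Finset.sum_congr rfl fun k hk => by rw [key k hk]]
  by_cases hjs : j ∈ s
  · rw [if_pos hjs, map_zero, zero_add, Finset.sum_eq_single_of_mem j hjs]
    · have hs : koszulSign K j s = 1 := by
        unfold koszulSign
        rw [Finset.filter_eq_empty_iff.2, Finset.card_empty, pow_zero]
        exact fun k hk hkj => absurd (hmin k (by simp [koszulActive, hk])) (not_le.2 hkj)
      simp [hs, Finset.insert_erase hjs]
    · intro k hk hkj
      rw [if_pos (Finset.mem_erase.2 ⟨Ne.symm hkj, hjs⟩), smul_zero]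
  · have hta : t ≤ a j := by simpa [koszulActive, hjs] using hj
    have haj : a - Finsupp.single j t + Finsupp.single j t = a :=
      tsub_add_cancel_of_le (Finsupp.single_le_iff.2 hta)
    rw [if_neg hjs, koszulD_single_monomial, Finset.sum_insert hjs, haj, Finset.erase_insert hjs,
      add_assoc, ← Finset.sum_add_distrib, Finset.sum_eq_zero, add_zero]
    · have hs : koszulSign K j (insert j s) = 1 := by
        unfold koszulSign
        rw [Finset.filter_eq_empty_iff.2, Finset.card_empty, pow_zero]
        intro k hk hkj
        rcases Finset.mem_insert.1 hk with rfl | hk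
        · exact lt_irrefl _ hkj
        · exact absurd (hmin k (by simp [koszulActive, hk])) (not_le.2 hkj)
      rw [hs, one_smul]
    · intro k hk
      have hkj : k ≠ j := fun h => hjs (h ▸ hk)
      have h1 : j ∉ s.erase k := fun h => hjs (Finset.mem_of_mem_erase h)
      have h2 : (insert j s).erase k = insert j (s.erase k) :=
        Finset.erase_insert_of_ne (Ne.symm hkj)
      have h3 : a + Finsupp.single k t - Finsupp.single j t =
          a - Finsupp.single j t + Finsupp.single k t :=
        tsub_add_eq_add_tsub (Finsupp.single_le_iff.2 hta) |>.symm
      have h4 : koszulSign K k (insert j s) = - koszulSign K k s := by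
        rw [koszulSign_mul_erase (hlt k hk hkj) (Finset.mem_insert_self j s),
          Finset.erase_insert hjs]
      rw [if_neg h1, h2, h3, h4, neg_smul, neg_add_cancel]

lemma koszul_homotopy {i : ℕ} (t : ℕ) {z : Finset (Fin n) →₀ MvPolynomial (Fin n) K}
    (hz : z ∈ koszulX (MvPolynomial (Fin n) K) n (i + 1)) :
    koszulD (varPow K n t) (koszulH K n t z) + koszulH K n t (koszulD (varPow K n t) z) = z := by
  let P : (Finset (Fin n) →₀ MvPolynomial (Fin n) K) →ₗ[K]
      (Finset (Fin n) →₀ MvPolynomial (Fin n) K) :=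
    (koszulD (varPow K n t)).restrictScalars K ∘ₗ koszulH K n t +
      koszulH K n t ∘ₗ (koszulD (varPow K n t)).restrictScalars K - LinearMap.id
  suffices h : P.toAddMonoidHom z ∈ (⊥ : AddSubgroup _) by
    have h' : P z = 0 := h
    exact sub_eq_zero.1 h'
  refine koszulX_le _ _ (fun s hs p => ?_) hz
  have hsne : s.Nonempty := Finset.card_pos.1 (by omega)
  have : P ∘ₗ Finsupp.lsingle s = 0 := by
    refine (basisMonomials (Fin n) K).ext fun a => ?_
    have := koszul_homotopy_of_active (K := K) t s a
      (hsne.mono Finset.subset_union_left)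
    simpa [P, sub_eq_zero] using this
  exact DFunLike.congr_fun this p

lemma koszulH_mem {i : ℕ} (t : ℕ) {z : Finset (Fin n) →₀ MvPolynomial (Fin n) K}
    (hz : z ∈ koszulX (MvPolynomial (Fin n) K) n i) :
    koszulH K n t z ∈ koszulX (MvPolynomial (Fin n) K) n (i + 1) := by
  let N := (koszulX (MvPolynomial (Fin n) K) n (i + 1)).restrictScalars K
  refine koszulX_le (koszulH K n t).toAddMonoidHom N.toAddSubgroup (fun s hs p => ?_) hz
  have hle : (⊤ : Submodule K (MvPolynomial (Fin n) K)) ≤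
      N.comap (koszulH K n t ∘ₗ Finsupp.lsingle s) := by
    rw [← (basisMonomials (Fin n) K).span_eq, Submodule.span_le]
    rintro _ ⟨a, rfl⟩
    simp only [coe_basisMonomials, SetLike.mem_coe, Submodule.mem_comap, LinearMap.comp_apply,
      Finsupp.lsingle_apply, koszulH_single]
    split_ifs
    · exact zero_mem _
    · rename_i h'
      · refine Finsupp.single_mem_supported (MvPolynomial (Fin n) K) _ ?_
        simp [Finset.card_insert_of_notMem h', hs]
    · exact zero_mem _
  exact hle (Submodule.mem_top (x := p))

/-- The augmentation `K_0 = R e_∅ → R / (X_1^t, …, X_n^t)`. -/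
def koszulAug (K : Type u) [Field K] (n t : ℕ) :
    koszulX (MvPolynomial (Fin n) K) n 0 →ₗ[MvPolynomial (Fin n) K]
      (MvPolynomial (Fin n) K ⧸ varPowIdeal K n t) :=
  Submodule.mkQ _ ∘ₗ Finsupp.lapply ∅ ∘ₗ Submodule.subtype _

lemma eq_single_of_mem_koszulX_zero {R : Type u} [CommRing R] {z : Finset (Fin n) →₀ R}
    (hz : z ∈ koszulX R n 0) : z = Finsupp.single ∅ (z ∅) := by
  ext s
  by_cases hs : s = ∅
  · subst hs; simp
  · rw [Finsupp.single_apply, if_neg (Ne.symm hs)]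
    by_contra h
    exact hs (Finset.card_eq_zero.1 (hz (Finsupp.mem_support_iff.2 h)))

lemma koszul_exact_zero (t : ℕ) (z : koszulX (MvPolynomial (Fin n) K) n 0) :
    koszulAug K n t z = 0 ↔
      ∃ y : koszulX (MvPolynomial (Fin n) K) n 1, koszulD (varPow K n t) y.1 = z.1 := by
  obtain ⟨z, hz⟩ := z
  have h1 : koszulAug K n t ⟨z, hz⟩ = 0 ↔ z ∅ ∈ varPowIdeal K n t :=
    Submodule.Quotient.mk_eq_zero _
  have hD : ∀ (j : Fin n) (r : MvPolynomial (Fin n) K),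
      koszulD (varPow K n t) (Finsupp.single {j} r) = Finsupp.single ∅ (varPow K n t j * r) := by
    intro j r
    rw [koszulD_single, Finset.sum_singleton]
    have hs : koszulSign (MvPolynomial (Fin n) K) j {j} = 1 := by
      unfold koszulSign
      rw [Finset.filter_eq_empty_iff.2, Finset.card_empty, pow_zero]
      simp
    rw [hs, one_mul, Finset.erase_singleton]
  rw [h1]
  constructor
  · intro h
    obtain ⟨c, hc⟩ := (Ideal.mem_span_range_iff_exists_fun).1 h
    refine ⟨⟨∑ j, Finsupp.single {j} (c j), sum_mem fun j _ =>
      Finsupp.single_mem_supported _ _ (Finset.card_singleton j)⟩, ?_⟩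
    dsimp only
    rw [map_sum, eq_single_of_mem_koszulX_zero hz, ← hc, Finsupp.single_finsetSum]
    exact Finset.sum_congr rfl fun j _ => by rw [hD, mul_comm]
  · rintro ⟨⟨y, hy⟩, hyz⟩
    dsimp only at hyz
    rw [← hyz]
    refine koszulX_le ((Finsupp.lapply (R := MvPolynomial (Fin n) K) ∅ ∘ₗ
      koszulD (varPow K n t)).toAddMonoidHom) (varPowIdeal K n t).toAddSubgroup
      (fun s hs r => ?_) hy
    obtain ⟨j, rfl⟩ := Finset.card_eq_one.1 hs
    have : koszulD (varPow K n t) (Finsupp.single {j} r) ∅ ∈ varPowIdeal K n t := by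
      rw [hD, Finsupp.single_eq_same]
      exact Ideal.mul_mem_right _ _ (Ideal.subset_span ⟨j, rfl⟩)
    exact this

lemma koszulComplex_d {R : Type u} [CommRing R] (x : Fin n → R) (i : ℕ) :
    (koszulComplex x).d (i + 1) i =
      ModuleCat.ofHom ((koszulD x).restrict fun _ hz => koszulD_mem (i := i) x hz) :=
  ChainComplex.of_d (fun i => ModuleCat.of R (koszulX R n i))
    (fun i => ModuleCat.ofHom ((koszulD x).restrict fun _ hz => koszulD_mem (i := i) x hz)) i

instance koszulComplex_projective {R : Type u} [CommRing R] (x : Fin n → R) (i : ℕ) :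
    Projective ((koszulComplex x).X i) := by
  have : Module.Free R (koszulX R n i) :=
    Module.Free.of_equiv (Finsupp.supportedEquivFinsupp {s : Finset (Fin n) | s.card = i}).symm
  exact ModuleCat.projective_of_free (Module.Free.chooseBasis R (koszulX R n i))

lemma koszulComplex_d_comp_aug (t : ℕ) :
    (koszulComplex (varPow K n t)).d 1 0 ≫ ModuleCat.ofHom (koszulAug K n t) = 0 := by
  rw [koszulComplex_d]
  refine ModuleCat.hom_ext (LinearMap.ext fun y => ?_)
  exact (koszul_exact_zero t _).2 ⟨y, rfl⟩

lemma koszulAug_surjective (t : ℕ) : Function.Surjective (koszulAug K n t) := by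
  intro y
  obtain ⟨r, rfl⟩ := Submodule.Quotient.mk_surjective _ y
  refine ⟨⟨Finsupp.single ∅ r, Finsupp.single_mem_supported _ _ Finset.card_empty⟩, ?_⟩
  change Submodule.Quotient.mk ((Finsupp.single ∅ r : _ →₀ _) ∅) = _
  rw [Finsupp.single_eq_same]

/-- The augmentation, as a morphism of complexes. -/
def koszulπ (K : Type u) [Field K] (n t : ℕ) :
    koszulComplex (varPow K n t) ⟶ (ChainComplex.single₀ _).obj
      (ModuleCat.of (MvPolynomial (Fin n) K) (MvPolynomial (Fin n) K ⧸ varPowIdeal K n t)) :=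
  (ChainComplex.toSingle₀Equiv _ _).symm
    ⟨ModuleCat.ofHom (koszulAug K n t), koszulComplex_d_comp_aug t⟩

lemma koszulπ_quasiIso (t : ℕ) : QuasiIso (koszulπ K n t) where
  quasiIsoAt m := by
    cases m with
    | zero =>
      rw [ChainComplex.quasiIsoAt₀_iff, ShortComplex.quasiIso_iff_of_zeros' _ rfl rfl rfl]
      constructor
      · rw [ShortComplex.moduleCat_exact_iff]
        intro z hz
        have hz' : koszulAug K n t z = 0 := by
          have h2 : (koszulπ K n t).f 0 = ModuleCat.ofHom (koszulAug K n t) :=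
            ChainComplex.toSingle₀Equiv_symm_apply_f_zero _ _
          have h3 : ((koszulπ K n t).f 0).hom z = 0 := hz
          rw [h2] at h3
          exact h3
        obtain ⟨y, hy⟩ := (koszul_exact_zero t z).1 hz'
        refine ⟨y, ?_⟩
        change ((koszulComplex (varPow K n t)).d 1 0).hom y = z
        rw [koszulComplex_d]
        exact Subtype.ext hy
      · have h2 : (koszulπ K n t).f 0 = ModuleCat.ofHom (koszulAug K n t) :=
          ChainComplex.toSingle₀Equiv_symm_apply_f_zero _ _
        change Epi ((koszulπ K n t).f 0)
        rw [h2]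
        exact (ModuleCat.epi_iff_surjective (R := MvPolynomial (Fin n) K)
          (X := ModuleCat.of _ (koszulX (MvPolynomial (Fin n) K) n 0))
          (Y := ModuleCat.of _ (MvPolynomial (Fin n) K ⧸ varPowIdeal K n t))
          (ModuleCat.ofHom (koszulAug K n t))).2 (koszulAug_surjective t)
    | succ m =>
      rw [quasiIsoAt_iff_exactAt' (hL := ChainComplex.exactAt_succ_single_obj ..),
        HomologicalComplex.exactAt_iff' _ (m + 2) (m + 1) m (by simp) (by simp),
        ShortComplex.moduleCat_exact_iff]
      intro z hz
      have hz' : koszulD (varPow K n t) z.1 = 0 := by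
        have h3 : ((koszulComplex (varPow K n t)).d (m + 1) m).hom z = 0 := hz
        rw [koszulComplex_d] at h3
        exact congrArg Subtype.val h3
      refine ⟨⟨koszulH K n t z.1, koszulH_mem t z.2⟩, ?_⟩
      change ((koszulComplex (varPow K n t)).d (m + 2) (m + 1)).hom _ = z
      rw [koszulComplex_d]
      refine Subtype.ext ?_
      have := koszul_homotopy t z.2
      rwa [hz', map_zero, add_zero] at this

/-- The Koszul complex of `X_1^t, …, X_n^t` is a free resolution of `S / (X_1^t, …, X_n^t)`. -/
def koszulResolution (K : Type u) [Field K] (n t : ℕ) :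
    ProjectiveResolution
      (ModuleCat.of (MvPolynomial (Fin n) K) (MvPolynomial (Fin n) K ⧸ varPowIdeal K n t)) where
  complex := koszulComplex (varPow K n t)
  π := koszulπ K n t
  quasiIso := koszulπ_quasiIso t

end Resolution

/-! ### The canonical map from Koszul cohomology to local cohomology -/

section LocalCohomology

open MvPolynomial

/-- For `𝔪 ^ N ⊆ J`, the canonical map
`Ext^i(R / J, M) → Ext^i(R / 𝔪 ^ N, M) → colim_N Ext^i(R / 𝔪 ^ N, M) = H^i_𝔪(M)`. -/
def extToLocalCohomology {R : Type u} [CommRing R] {J 𝔪 : Ideal R} (N : ℕ) (h : 𝔪 ^ N ≤ J)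
    (i : ℕ) (M : ModuleCat.{u} R) :
    ((Ext R (ModuleCat.{u} R) i).obj (op (ModuleCat.of R (R ⧸ J)))).obj M ⟶
      (localCohomology 𝔪 i).obj M :=
  ((Ext R (ModuleCat.{u} R) i).map (ModuleCat.ofHom (Submodule.factor h)).op ≫
    Limits.colimit.ι (localCohomology.diagram (localCohomology.idealPowersDiagram 𝔪) i)
      (op (op N))).app M

variable (K : Type u) [Field K] (n : ℕ)

/-- The homogeneous maximal ideal `(X_1, …, X_n)` of `K[X_1, …, X_n]`. -/
def irrelevantIdeal : Ideal (MvPolynomial (Fin n) K) := Ideal.span (Set.range X)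

variable {K n}

/-- The canonical map `H^i(X_1^t, …, X_n^t; M) → H^i_𝔪(M)`: the Koszul complex
resolves `S / (X_1^t, …, X_n^t)`, so the source is `Ext^i(S / (X_1^t, …, X_n^t), M)`. -/
def koszulToLocalCohomology (t N : ℕ) (h : irrelevantIdeal K n ^ N ≤ varPowIdeal K n t) (i : ℕ)
    (M : ModuleCat.{u} (MvPolynomial (Fin n) K)) :
    koszulCohomology (varPow K n t) i M ⟶ (localCohomology (irrelevantIdeal K n) i).obj M :=
  ((koszulResolution K n t).isoExt i M).inv ≫ extToLocalCohomology N h i M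

lemma irrelevantIdeal_pow_one_le : irrelevantIdeal K n ^ 1 ≤ varPowIdeal K n 1 := by
  have h : varPow K n 1 = X := funext fun j => pow_one _
  rw [pow_one, irrelevantIdeal, varPowIdeal, h]

/-- The standard graded ring `S / J` (with `J` a homogeneous ideal of `S = K[X_1, …, X_n]`)
is Buchsbaum if the canonical map `H^i(𝔪; S / J) → H^i_𝔪(S / J)` from Koszul cohomology with
respect to `X_1, …, X_n` is surjective for all `i < dim S / J`. -/
def IsBuchsbaumQuotient (J : Ideal (MvPolynomial (Fin n) K)) : Prop :=
  ∀ i : ℕ, (i : WithBot ℕ∞) < ringKrullDim (MvPolynomial (Fin n) K ⧸ J) →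
    Function.Surjective (koszulToLocalCohomology 1 1 irrelevantIdeal_pow_one_le i
      (ModuleCat.of (MvPolynomial (Fin n) K) (MvPolynomial (Fin n) K ⧸ J))).hom

/-! ### The multigrading -/

/-- The component of multidegree `b ∈ ℤ^n` of `S / J`, for a monomial ideal `J`: it is spanned by
the residue class of `X^b` if `b ≥ 0`, and zero otherwise. -/
def quotientDegree (J : Ideal (MvPolynomial (Fin n) K)) (b : Fin n → ℤ) :
    Submodule K (MvPolynomial (Fin n) K ⧸ J) :=
  Submodule.span K
    {p | ∃ e : Fin n →₀ ℕ, (∀ j, (e j : ℤ) = b j) ∧ p = Ideal.Quotient.mk J (monomial e 1)}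

/-- A cochain `φ : K_i(X_1^t, …, X_n^t) → S / J` has multidegree `a` if it maps `e_s`,
which has multidegree `t ∑_{j ∈ s} ε_j`, to an element of multidegree `a + t ∑_{j ∈ s} ε_j`. -/
def HasKoszulDegree (t : ℕ) {i : ℕ} (J : Ideal (MvPolynomial (Fin n) K)) (a : Fin n → ℤ)
    (φ : (koszulComplex (varPow K n t)).X i ⟶
      ModuleCat.of (MvPolynomial (Fin n) K) (MvPolynomial (Fin n) K ⧸ J)) : Prop :=
  ∀ (s : Finset (Fin n)) (hs : s.card = i),
    φ.hom (koszulBasis (MvPolynomial (Fin n) K) s hs) ∈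
      quotientDegree J fun j => a j + if j ∈ s then (t : ℤ) else 0

/-- `H^i_𝔪(S / J)`, regarded as a `K`-vector space. -/
abbrev localCohomologySpace (J : Ideal (MvPolynomial (Fin n) K)) (i : ℕ) : ModuleCat.{u} K :=
  (ModuleCat.restrictScalars (algebraMap K (MvPolynomial (Fin n) K))).obj
    ((localCohomology (irrelevantIdeal K n) i).obj
      (ModuleCat.of (MvPolynomial (Fin n) K) (MvPolynomial (Fin n) K ⧸ J)))

/-- The component of multidegree `a ∈ ℤ^n` of `H^i_𝔪(S / J)`, for a monomial ideal `J`: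
the elements that come from a cocycle of multidegree `a` in the Koszul complex of
`X_1^t, …, X_n^t` for some `t`. (`H^i_𝔪` is the colimit of these Koszul cohomology modules
`H^i(X_1^t, …, X_n^t; S / J) = Ext^i(S / (X_1^t, …, X_n^t), S / J)`.) -/
def localCohomologyDegree (J : Ideal (MvPolynomial (Fin n) K)) (i : ℕ) (a : Fin n → ℤ) :
    Submodule K (localCohomologySpace J i) :=
  Submodule.span K
    {η | ∃ (t N : ℕ) (h : irrelevantIdeal K n ^ N ≤ varPowIdeal K n t)
      (c : (koszulCochains (varPow K n t) (ModuleCat.of _ (MvPolynomial (Fin n) K ⧸ J))).cycles i),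
      HasKoszulDegree t J a (((koszulCochains (varPow K n t) _).iCycles i).hom c) ∧
      (koszulToLocalCohomology t N h i _).hom
        (((koszulCochains (varPow K n t) _).homologyπ i).hom c) = η}

end LocalCohomology

end

/-! With variables numbered from 0, the facets {0,1}, {1,2}, {2,3} have primes P_0 = (X_2, X_3), P_1
= (X_0, X_3), P_2 = (X_0, X_1). The ideal I^2 is the intersection of the P_m^2
(`mem_pathIdeal_sq_iff`), so membership in I^2 is a condition on coefficients, one facet at a time,
and the variables X_m, X_{m+1} of a facet are nonzerodivisors modulo P_m^2.

A Koszul 1-cocycle p for the t-th powers of the variables can therefore be divided on each facet: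
p_j = X_j^t g_m modulo P_m^2 for all j. A common g exists iff the g_m agree on every monomial
standard for several facets. Neighbouring facets share a vertex, which forces agreement. Only a
monomial standard for facets 0 and 2 but not for 1 can obstruct, and the only one is X_0 X_3
(`eq_endsExponent`). The difference of the two coefficients there is `pathInvariant`. It vanishes
exactly on coboundaries (`IsPathCocycle.exists_coboundary`) and is unchanged when t grows, so it
detects the classes in H^1_𝔪 (`cycleClass_eq_zero_iff_pathInvariant`). Hence H^1_𝔪 is one copy of K
in degree (1,0,0,1), spanned by a class already present at t = 1. Together with H^0_𝔪 = 0 this gives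
Buchsbaumness.

The same generating cocycle bounds the depth by 1, both with respect to 𝔪 and after localizing at 𝔪
(`moduleDepth_le_one`), while X_1 + X_2 is regular. The dimension is 2: primes over I contain two of
the variables, and a facet supplies a chain of length 2. So the ring is not Cohen–Macaulay.

To compute with cocycles, H^i_𝔪, a colimit of Ext over powers of 𝔪, is compared with Koszul
cohomology of powers of the variables. The two families of ideals are cofinal, and naturality of
`isoExt` identifies the transition maps (`koszulTransition_comp_koszulToLocalCohomology`). -/

/-! ### Naturality of computing Ext from projective resolutions. -/

section ExtNaturality

variable {R : Type*} [Ring R] {C : Type*} [Category* C] [Abelian C] [Linear R C]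

/-- Precomposition with a chain map, as a morphism of cochain complexes of homomorphisms. -/
noncomputable def linearYonedaObjMap {P Q : ChainComplex C ℕ} (φ : P ⟶ Q) (M : C) :
    Q.linearYonedaObj R M ⟶ P.linearYonedaObj R M :=
  (HomologicalComplex.unopFunctor _ _).map
    ((((linearYoneda R C).obj M).rightOp.mapHomologicalComplex _).map φ).op

variable [EnoughProjectives C]

/-- `isoExt` unfolds to `isoLeftDerivedObj` in the opposite category followed by `homologyOp`, so
its naturality is the pasting of the naturality squares of these two, read through `unop`. -/
lemma CategoryTheory.ProjectiveResolution.isoExt_inv_naturality {X Y : C} (f : X ⟶ Y)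
    (P : ProjectiveResolution X) (Q : ProjectiveResolution Y) (φ : P.complex ⟶ Q.complex)
    (comm : φ.f 0 ≫ Q.π.f 0 = P.π.f 0 ≫ f) (n : ℕ) (M : C) :
    (Q.isoExt (R := R) n M).inv ≫ ((Ext R C n).map f.op).app M =
      HomologicalComplex.homologyMap (linearYonedaObjMap φ M) n ≫ (P.isoExt n M).inv := by
  have h1 := ProjectiveResolution.isoLeftDerivedObj_hom_naturality f P Q φ comm
    ((linearYoneda R C).obj M).rightOp n
  have h1' := congrArg Quiver.Hom.unop h1
  have h2 := congrArg Quiver.Hom.unop (HomologicalComplex.homologyOp_hom_naturality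
    (linearYonedaObjMap (R := R) φ M) n)
  have e₁ : (Q.isoExt (R := R) n M).inv ≫ ((Ext R C n).map f.op).app M =
      ((Q.complex.linearYonedaObj R M).homologyOp n).hom.unop ≫
        ((Q.isoLeftDerivedObj ((linearYoneda R C).obj M).rightOp n).hom.unop ≫
          ((((linearYoneda R C).obj M).rightOp.leftDerived n).map f).unop) :=
    Category.assoc _ _ _
  have e₂ := congrArg (((Q.complex.linearYonedaObj R M).homologyOp n).hom.unop ≫ ·) h1'
  have e₃ := congrArg
    (· ≫ (P.isoLeftDerivedObj ((linearYoneda R C).obj M).rightOp n).hom.unop) h2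
  have e₄ : (HomologicalComplex.homologyMap (linearYonedaObjMap φ M) n ≫
      ((P.complex.linearYonedaObj R M).homologyOp n).hom.unop) ≫
        (P.isoLeftDerivedObj ((linearYoneda R C).obj M).rightOp n).hom.unop =
      HomologicalComplex.homologyMap (linearYonedaObjMap φ M) n ≫ (P.isoExt n M).inv :=
    Category.assoc _ _ _
  exact e₁.trans (e₂.trans ((Category.assoc _ _ _).symm.trans (e₃.trans e₄)))

end ExtNaturality

noncomputable section

/-! ### Chain maps between Koszul complexes. -/

section KoszulScale

variable {R : Type u} [CommRing R] {n : ℕ}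

/-- The map `e_s ↦ (∏_{j ∈ s} y_j) e_s`. -/
def koszulScale (y : Fin n → R) : (Finset (Fin n) →₀ R) →ₗ[R] (Finset (Fin n) →₀ R) :=
  Finsupp.linearCombination R fun s => Finsupp.single s (∏ j ∈ s, y j)

lemma koszulScale_single (y : Fin n → R) (s : Finset (Fin n)) (r : R) :
    koszulScale y (Finsupp.single s r) = Finsupp.single s ((∏ j ∈ s, y j) * r) := by
  rw [koszulScale, Finsupp.linearCombination_single, Finsupp.smul_single, smul_eq_mul, mul_comm]

lemma koszulScale_mem (y : Fin n → R) {i : ℕ} {z : Finset (Fin n) →₀ R}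
    (hz : z ∈ koszulX R n i) : koszulScale y z ∈ koszulX R n i := by
  refine koszulX_le (koszulScale y).toAddMonoidHom (koszulX R n i).toAddSubgroup ?_ hz
  intro s hs r
  simp only [LinearMap.toAddMonoidHom_coe, koszulScale_single, Submodule.mem_toAddSubgroup]
  exact Finsupp.single_mem_supported R _ hs

lemma koszulScale_apply_empty (y : Fin n → R) (z : Finset (Fin n) →₀ R) :
    koszulScale y z ∅ = z ∅ := by
  induction z using Finsupp.induction_linear with
  | zero => simp
  | add f g hf hg => simp [hf, hg]
  | single s r =>
    rw [koszulScale_single]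
    by_cases hs : s = ∅
    · subst hs; simp
    · simp [hs]

/-- The product of the y's over `s.erase j` lacks the factor y_j, and this is the extra factor in
x'_j = x_j y_j. -/
lemma koszulD_koszulScale {x x' y : Fin n → R} (h : ∀ j, x' j = x j * y j) :
    koszulD x ∘ₗ koszulScale y = koszulScale y ∘ₗ koszulD x' := by
  ext1 s
  ext1
  simp only [LinearMap.comp_apply, Finsupp.lsingle_apply, koszulD_single, map_sum,
    koszulScale_single]
  refine Finset.sum_congr rfl fun j hj => ?_
  rw [h j, ← Finset.mul_prod_erase s y hj]
  congr 1
  ring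

/-- The chain map `K_•(x y) → K_•(x)`, `e_s ↦ (∏_{j ∈ s} y_j) e_s`. -/
def koszulScaleMap {x x' y : Fin n → R} (h : ∀ j, x' j = x j * y j) :
    koszulComplex x' ⟶ koszulComplex x where
  f i := ModuleCat.ofHom ((koszulScale y).restrict fun _ hz => koszulScale_mem (i := i) y hz)
  comm' i j hij := by
    obtain rfl : j + 1 = i := hij
    rw [koszulComplex_d, koszulComplex_d]
    refine ModuleCat.hom_ext (LinearMap.ext fun z => Subtype.ext ?_)
    exact DFunLike.congr_fun (koszulD_koszulScale h) z.1

end KoszulScale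

/-! ### Local cohomology as a filtered colimit of Ext modules. -/

section ExtToLocalCohomology

variable {R : Type u} [CommRing R]

/-- The map `Ext^i(R / J, M) → Ext^i(R / J', M)` for `J' ≤ J`. -/
def extFactor {J J' : Ideal R} (h : J' ≤ J) (i : ℕ) (M : ModuleCat.{u} R) :
    ((Ext R (ModuleCat.{u} R) i).obj (op (ModuleCat.of R (R ⧸ J)))).obj M ⟶
      ((Ext R (ModuleCat.{u} R) i).obj (op (ModuleCat.of R (R ⧸ J')))).obj M :=
  ((Ext R (ModuleCat.{u} R) i).map (ModuleCat.ofHom (Submodule.factor h)).op).app M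

lemma extFactor_comp {J J' J'' : Ideal R} (h : J' ≤ J) (h' : J'' ≤ J') (i : ℕ)
    (M : ModuleCat.{u} R) :
    extFactor h i M ≫ extFactor h' i M = extFactor (h'.trans h) i M := by
  rw [extFactor, extFactor, ← NatTrans.comp_app, ← Functor.map_comp, extFactor]
  congr 2
  rw [← op_comp]
  congr 1
  refine ModuleCat.hom_ext (LinearMap.ext fun z => ?_)
  obtain ⟨r, rfl⟩ := Submodule.Quotient.mk_surjective _ z
  rfl

/-- The canonical map `Ext^i(R / 𝔪 ^ N, M) → H^i_𝔪(M)`. -/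
def extι (𝔪 : Ideal R) (N i : ℕ) (M : ModuleCat.{u} R) :
    ((Ext R (ModuleCat.{u} R) i).obj (op (ModuleCat.of R (R ⧸ 𝔪 ^ N)))).obj M ⟶
      (localCohomology 𝔪 i).obj M :=
  (Limits.colimit.ι
    (localCohomology.diagram (localCohomology.idealPowersDiagram 𝔪) i) (op (op N))).app M

lemma extToLocalCohomology_eq {J 𝔪 : Ideal R} {N : ℕ} (h : 𝔪 ^ N ≤ J) (i : ℕ)
    (M : ModuleCat.{u} R) :
    extToLocalCohomology N h i M = extFactor h i M ≫ extι 𝔪 N i M :=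
  rfl

lemma extFactor_comp_ι {𝔪 : Ideal R} {N N' : ℕ} (h : N ≤ N') (i : ℕ) (M : ModuleCat.{u} R) :
    extFactor (Ideal.pow_le_pow_right (I := 𝔪) h) i M ≫ extι 𝔪 N' i M = extι 𝔪 N i M := by
  have := Limits.colimit.w (localCohomology.diagram (localCohomology.idealPowersDiagram 𝔪) i)
    (homOfLE h).op.op
  exact congrArg (fun α => α.app M) this

lemma extToLocalCohomology_of_le {J 𝔪 : Ideal R} {N N' : ℕ} (hN : N ≤ N') (h : 𝔪 ^ N ≤ J) (i : ℕ)
    (M : ModuleCat.{u} R) :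
    extToLocalCohomology N' ((Ideal.pow_le_pow_right hN).trans h) i M =
      extToLocalCohomology N h i M := by
  rw [extToLocalCohomology_eq, extToLocalCohomology_eq, ← extFactor_comp_ι hN i M,
    ← extFactor_comp h (Ideal.pow_le_pow_right hN), Category.assoc]

/-- Both exponents are compared with their maximum. This makes the auxiliary N in the canonical maps
harmless. -/
lemma extToLocalCohomology_indep {J 𝔪 : Ideal R} {N N' : ℕ} (h : 𝔪 ^ N ≤ J) (h' : 𝔪 ^ N' ≤ J)
    (i : ℕ) (M : ModuleCat.{u} R) :
    extToLocalCohomology N' h' i M = extToLocalCohomology N h i M := by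
  rw [← extToLocalCohomology_of_le (le_max_left N N') h,
    ← extToLocalCohomology_of_le (le_max_right N N') h']

lemma extFactor_comp_extToLocalCohomology {J J' 𝔪 : Ideal R} {N : ℕ} (h : J' ≤ J)
    (hN : 𝔪 ^ N ≤ J') (i : ℕ) (M : ModuleCat.{u} R) :
    extFactor h i M ≫ extToLocalCohomology N hN i M =
      extToLocalCohomology N (hN.trans h) i M := by
  rw [extToLocalCohomology_eq, extToLocalCohomology_eq, ← extFactor_comp h hN, Category.assoc]

/-- The index category lives in universe 0 and the modules in universe u, so preservation of
filtered colimits has to be shrunk before elements of the colimit can be represented. -/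
instance : Limits.PreservesColimitsOfShape (ℕᵒᵖᵒᵖ) (forget (ModuleCat.{u} R)) := by
  have := Limits.preservesFilteredColimitsOfSize_shrink.{0, u, 0, u} (forget (ModuleCat.{u} R))
  infer_instance

lemma localCohomology_exists_rep {𝔪 : Ideal R} {i : ℕ} {M : ModuleCat.{u} R}
    (η : (localCohomology 𝔪 i).obj M) :
    ∃ (N : ℕ) (e : ((Ext R (ModuleCat.{u} R) i).obj (op (ModuleCat.of R (R ⧸ 𝔪 ^ N)))).obj M),
      (extι 𝔪 N i M).hom e = η := by
  have hc := Limits.isColimitOfPreserves ((evaluation _ _).obj M) (Limits.colimit.isColimit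
    (localCohomology.diagram (localCohomology.idealPowersDiagram 𝔪) i))
  obtain ⟨⟨⟨N⟩⟩, e, he⟩ := Limits.Concrete.isColimit_exists_rep _ hc η
  exact ⟨N, e, he⟩

lemma localCohomology_exists_of_eq_zero {𝔪 : Ideal R} {i : ℕ} {M : ModuleCat.{u} R} {N : ℕ}
    (e : ((Ext R (ModuleCat.{u} R) i).obj (op (ModuleCat.of R (R ⧸ 𝔪 ^ N)))).obj M)
    (he : (extι 𝔪 N i M).hom e = 0) :
    ∃ (N' : ℕ) (h : N ≤ N'), (extFactor (Ideal.pow_le_pow_right (I := 𝔪) h) i M).hom e = 0 := by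
  have hc := Limits.isColimitOfPreserves ((evaluation _ _).obj M) (Limits.colimit.isColimit
    (localCohomology.diagram (localCohomology.idealPowersDiagram 𝔪) i))
  -- The comparison is with the zero element of the same stage, so the second arrow `g` only has to
  -- send 0 to 0.
  obtain ⟨⟨⟨N'⟩⟩, f, g, h⟩ := Limits.Concrete.isColimit_exists_of_rep_eq
    (i := op (op N)) (j := op (op N)) _ hc e
    (0 : ((Ext R (ModuleCat.{u} R) i).obj (op (ModuleCat.of R (R ⧸ 𝔪 ^ N)))).obj M)
    (he.trans (map_zero _).symm)
  exact ⟨N', leOfHom f.unop.unop, h.trans (map_zero _)⟩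

end ExtToLocalCohomology

/-! ### Cofinality of powers of the variables, and the Koszul transition maps. -/

section Transition

open MvPolynomial

variable {K : Type u} [Field K] {n : ℕ}

/-- The chain map between the Koszul complexes of powers of the variables. -/
def koszulPowMap (K : Type u) [Field K] (n : ℕ) {t t' : ℕ} (h : t ≤ t') :
    koszulComplex (varPow K n t') ⟶ koszulComplex (varPow K n t) :=
  koszulScaleMap (y := varPow K n (t' - t)) fun j => by
    simp only [varPow, ← pow_add, Nat.add_sub_cancel' h]

lemma varPowIdeal_anti {t t' : ℕ} (h : t ≤ t') : varPowIdeal K n t' ≤ varPowIdeal K n t := by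
  refine Ideal.span_le.2 ?_
  rintro _ ⟨j, rfl⟩
  have hj : varPow K n t j ∈ varPowIdeal K n t := Ideal.subset_span ⟨j, rfl⟩
  exact Ideal.mem_of_dvd _ (pow_dvd_pow (X j) h) hj

lemma varPowIdeal_le_irrelevantIdeal_pow (t : ℕ) : varPowIdeal K n t ≤ irrelevantIdeal K n ^ t := by
  refine Ideal.span_le.2 ?_
  rintro _ ⟨j, rfl⟩
  have hj : (X j : MvPolynomial (Fin n) K) ∈ irrelevantIdeal K n := Ideal.subset_span ⟨j, rfl⟩
  exact Ideal.pow_mem_pow hj t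

/-- Each variable lies in the radical of (X_1^t, …, X_n^t), and 𝔪 is finitely generated. This is the
second half of cofinality. -/
lemma exists_irrelevantIdeal_pow_le (t : ℕ) :
    ∃ N, irrelevantIdeal K n ^ N ≤ varPowIdeal K n t := by
  refine Ideal.exists_pow_le_of_le_radical_of_fg ?_ (IsNoetherian.noetherian _)
  refine Ideal.span_le.2 ?_
  rintro _ ⟨j, rfl⟩
  have hj : varPow K n t j ∈ varPowIdeal K n t := Ideal.subset_span ⟨j, rfl⟩
  exact Ideal.mem_radical_of_pow_mem (m := t) (Ideal.le_radical hj)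

/-- In degree 0 the scaling factor is an empty product, so the chain map lifts the projection
between the quotient rings. -/
lemma koszulPowMap_comm {t t' : ℕ} (h : t ≤ t') :
    (koszulPowMap K n h).f 0 ≫ (koszulResolution K n t).π.f 0 =
      (koszulResolution K n t').π.f 0 ≫
        ModuleCat.ofHom (Submodule.factor (varPowIdeal_anti h)) := by
  have h2 : ∀ t, (koszulResolution K n t).π.f 0 = ModuleCat.ofHom (koszulAug K n t) := fun t =>
    ChainComplex.toSingle₀Equiv_symm_apply_f_zero _ _
  rw [h2, h2]
  refine ModuleCat.hom_ext (LinearMap.ext fun z => ?_)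
  change Submodule.Quotient.mk (koszulScale _ z.1 ∅) = Submodule.Quotient.mk (z.1 ∅)
  rw [koszulScale_apply_empty]

/-- The isomorphism `Ext^i(S / (X_1^t, …, X_n^t), M) ≅ H^i(X_1^t, …, X_n^t; M)`. -/
def koszulExtIso (t i : ℕ) (M : ModuleCat.{u} (MvPolynomial (Fin n) K)) :
    ((Ext (MvPolynomial (Fin n) K) (ModuleCat.{u} (MvPolynomial (Fin n) K)) i).obj
      (op (ModuleCat.of _ (MvPolynomial (Fin n) K ⧸ varPowIdeal K n t)))).obj M ≅
      koszulCohomology (varPow K n t) i M :=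
  (koszulResolution K n t).isoExt i M

/-- The transition map `H^i(X_1^t, …, X_n^t; M) → H^i(X_1^t', …, X_n^t'; M)`. -/
def koszulTransition {t t' : ℕ} (h : t ≤ t') (i : ℕ)
    (M : ModuleCat.{u} (MvPolynomial (Fin n) K)) :
    koszulCohomology (varPow K n t) i M ⟶ koszulCohomology (varPow K n t') i M :=
  HomologicalComplex.homologyMap (linearYonedaObjMap (koszulPowMap K n h) M) i

lemma koszulTransition_comp_koszulExtIso_inv {t t' : ℕ} (h : t ≤ t') (i : ℕ)
    (M : ModuleCat.{u} (MvPolynomial (Fin n) K)) :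
    koszulTransition h i M ≫ (koszulExtIso t' i M).inv =
      (koszulExtIso t i M).inv ≫
        extFactor (varPowIdeal_anti h) i M := by
  have := ProjectiveResolution.isoExt_inv_naturality (R := MvPolynomial (Fin n) K)
    (ModuleCat.ofHom (Submodule.factor (varPowIdeal_anti (K := K) (n := n) h)))
    (koszulResolution K n t') (koszulResolution K n t) (koszulPowMap K n h)
    (koszulPowMap_comm h) i M
  exact this.symm

lemma koszulToLocalCohomology_eq (t N : ℕ) (h : irrelevantIdeal K n ^ N ≤ varPowIdeal K n t)
    (i : ℕ) (M : ModuleCat.{u} (MvPolynomial (Fin n) K)) :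
    koszulToLocalCohomology t N h i M =
      (koszulExtIso t i M).inv ≫ extToLocalCohomology N h i M := rfl

lemma koszulTransition_comp_koszulToLocalCohomology {t t' N N' : ℕ} (ht : t ≤ t')
    (h : irrelevantIdeal K n ^ N ≤ varPowIdeal K n t)
    (h' : irrelevantIdeal K n ^ N' ≤ varPowIdeal K n t') (i : ℕ)
    (M : ModuleCat.{u} (MvPolynomial (Fin n) K)) :
    koszulTransition ht i M ≫ koszulToLocalCohomology t' N' h' i M =
      koszulToLocalCohomology t N h i M := by
  have h1 : extFactor (varPowIdeal_anti ht) i M ≫ extToLocalCohomology N' h' i M =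
      extToLocalCohomology N h i M := by
    rw [extFactor_comp_extToLocalCohomology, extToLocalCohomology_indep h]
  rw [koszulToLocalCohomology_eq, koszulToLocalCohomology_eq, ← h1, ← Category.assoc,
    ← Category.assoc, koszulTransition_comp_koszulExtIso_inv]

/-- A class comes from Ext of S/𝔪^t₁ for some t₁, and (X_1^t, …, X_n^t) is contained in 𝔪^t₁ once t
≥ t₁. The bound `t₀` lets later arguments demand a large t. -/
lemma localCohomology_exists_koszul {i : ℕ} {M : ModuleCat.{u} (MvPolynomial (Fin n) K)}
    (η : (localCohomology (irrelevantIdeal K n) i).obj M) (t₀ : ℕ) :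
    ∃ (t N : ℕ) (h : irrelevantIdeal K n ^ N ≤ varPowIdeal K n t)
      (z : koszulCohomology (varPow K n t) i M),
      t₀ ≤ t ∧ (koszulToLocalCohomology t N h i M).hom z = η := by
  obtain ⟨t₁, e, rfl⟩ := localCohomology_exists_rep η
  have h₁ : varPowIdeal K n (max t₀ t₁) ≤ irrelevantIdeal K n ^ t₁ :=
    (varPowIdeal_le_irrelevantIdeal_pow _).trans (Ideal.pow_le_pow_right (le_max_right _ _))
  obtain ⟨N, h⟩ := exists_irrelevantIdeal_pow_le (K := K) (n := n) (max t₀ t₁)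
  refine ⟨max t₀ t₁, N, h,
    (koszulExtIso (max t₀ t₁) i M).hom.hom ((extFactor h₁ i M).hom e),
    le_max_left _ _, ?_⟩
  have h₂ : extFactor h₁ i M ≫ (koszulExtIso (max t₀ t₁) i M).hom ≫
      koszulToLocalCohomology _ N h i M = extι (irrelevantIdeal K n) t₁ i M := by
    rw [koszulToLocalCohomology_eq, Iso.hom_inv_id_assoc, extFactor_comp_extToLocalCohomology,
      extToLocalCohomology_indep le_rfl, extToLocalCohomology_eq]
    exact extFactor_comp_ι le_rfl i M
  exact congrArg (fun f => f.hom e) h₂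

/-- A class dying in the colimit already dies in Ext of some S/𝔪^N', hence also for any power ideal
of the variables inside 𝔪^N'. -/
lemma koszulTransition_eq_zero_of_koszulToLocalCohomology_eq_zero {i t N : ℕ}
    {h : irrelevantIdeal K n ^ N ≤ varPowIdeal K n t}
    {M : ModuleCat.{u} (MvPolynomial (Fin n) K)} (z : koszulCohomology (varPow K n t) i M)
    (hz : (koszulToLocalCohomology t N h i M).hom z = 0) :
    ∃ (t' : ℕ) (ht : t ≤ t'), (koszulTransition ht i M).hom z = 0 := by
  obtain ⟨N', hN, he⟩ := localCohomology_exists_of_eq_zero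
    ((extFactor h i M).hom ((koszulExtIso t i M).inv.hom z)) hz
  have h₁ : varPowIdeal K n (max t N') ≤ irrelevantIdeal K n ^ N' :=
    (varPowIdeal_le_irrelevantIdeal_pow _).trans (Ideal.pow_le_pow_right (le_max_right _ _))
  refine ⟨max t N', le_max_left _ _, ?_⟩
  have h₂ : koszulTransition (le_max_left t N') i M =
      (((koszulExtIso t i M).inv ≫ extFactor h i M) ≫
        extFactor (Ideal.pow_le_pow_right hN) i M) ≫ extFactor h₁ i M ≫
        (koszulExtIso (max t N') i M).hom := by
    rw [← cancel_mono (koszulExtIso (max t N') i M).inv,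
      koszulTransition_comp_koszulExtIso_inv]
    simp only [Category.assoc, Iso.hom_inv_id, Category.comp_id, extFactor_comp]
  rw [h₂]
  exact (congrArg (extFactor h₁ i M ≫ (koszulExtIso (max t N') i M).hom).hom he).trans
    (map_zero _)

end Transition


end

noncomputable section

/-! ### Elements of cycles and homology of a cochain complex. -/

section Cycles

variable {R : Type u} [CommRing R]

lemma cochainComplex_exists_cycle (L : CochainComplex (ModuleCat.{u} R) ℕ) (i : ℕ)
    (x : L.X i) (hx : (L.d i (i + 1)).hom x = 0) :
    ∃ c : L.cycles i, (L.iCycles i).hom c = x := by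
  have h : (ShortComplex.mk (L.iCycles i) (L.d i (i + 1)) (by simp)).Exact :=
    ShortComplex.exact_of_f_is_kernel _ (L.cyclesIsKernel i (i + 1) (by simp))
  exact (ShortComplex.moduleCat_exact_iff _).1 h x hx

lemma cochainComplex_d_iCycles (L : CochainComplex (ModuleCat.{u} R) ℕ) (i j : ℕ)
    (c : L.cycles i) : (L.d i j).hom ((L.iCycles i).hom c) = 0 :=
  congrArg (fun f => f.hom c) (L.iCycles_d i j)

lemma cochainComplex_iCycles_injective (L : CochainComplex (ModuleCat.{u} R) ℕ) (i : ℕ) :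
    Function.Injective (L.iCycles i).hom :=
  (ModuleCat.mono_iff_injective _).1 inferInstance

lemma cochainComplex_homologyπ_surjective (L : CochainComplex (ModuleCat.{u} R) ℕ) (i : ℕ) :
    Function.Surjective (L.homologyπ i).hom :=
  (ModuleCat.epi_iff_surjective _).1 inferInstance

lemma cochainComplex_homologyπ_eq_zero_iff (L : CochainComplex (ModuleCat.{u} R) ℕ) (i : ℕ)
    (c : L.cycles (i + 1)) :
    (L.homologyπ (i + 1)).hom c = 0 ↔ ∃ y : L.X i, (L.d i (i + 1)).hom y = (L.iCycles _).hom c := by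
  have h : (ShortComplex.mk (L.toCycles i (i + 1)) (L.homologyπ (i + 1)) (by simp)).Exact :=
    ShortComplex.exact_of_g_is_cokernel _ (L.homologyIsCokernel i (i + 1) (by simp))
  have hd : ∀ y : L.X i,
      (L.iCycles (i + 1)).hom ((L.toCycles i (i + 1)).hom y) = (L.d i (i + 1)).hom y := fun y =>
    congrArg (fun f => f.hom y) (L.toCycles_i i (i + 1))
  constructor
  · intro hc
    obtain ⟨y, hy⟩ := (ShortComplex.moduleCat_exact_iff _).1 h c hc
    exact ⟨y, by rw [← hd]; exact congrArg _ hy⟩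
  · rintro ⟨y, hy⟩
    have : (L.toCycles i (i + 1)).hom y = c :=
      cochainComplex_iCycles_injective L _ ((hd y).trans hy)
    rw [← this]
    exact congrArg (fun f => f.hom y) (L.toCycles_comp_homologyπ i (i + 1))

end Cycles

/-! ### Koszul 1-cochains as families of values on the e_j. -/

section KoszulCochains

variable {R : Type u} [CommRing R] {n : ℕ} {x : Fin n → R} {M : ModuleCat.{u} R}

lemma koszulX_hom_ext {i : ℕ} {φ ψ : (koszulComplex x).X i ⟶ M}
    (h : ∀ (s : Finset (Fin n)) (hs : s.card = i),
      φ.hom (koszulBasis R s hs) = ψ.hom (koszulBasis R s hs)) : φ = ψ := by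
  refine ModuleCat.hom_ext (LinearMap.ext fun z => ?_)
  obtain ⟨z, hz⟩ := z
  have hz' : z = ∑ s ∈ z.support, Finsupp.single s (z s) := (Finsupp.sum_single z).symm
  have : (⟨z, hz⟩ : koszulX R n i) =
      ∑ s ∈ z.support.attach, z s.1 • koszulBasis R s.1 (hz s.2) := by
    refine Subtype.ext ?_
    rw [AddSubmonoidClass.coe_finsetSum]
    refine hz'.trans ?_
    rw [← Finset.sum_attach]
    refine Finset.sum_congr rfl fun s _ => ?_
    simp [koszulBasis]
  have e : ∀ φ : (koszulComplex x).X i ⟶ M, φ.hom (⟨z, hz⟩ : koszulX R n i) =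
      ∑ s ∈ z.support.attach, z s.1 • φ.hom (koszulBasis R s.1 (hz s.2)) := by
    intro φ
    rw [this]
    exact (map_sum φ.hom _ _).trans (Finset.sum_congr rfl fun s _ => map_smul φ.hom _ _)
  refine (e φ).trans ((Finset.sum_congr rfl fun s _ => ?_).trans (e ψ).symm)
  rw [h]

/-- The values `φ(e_j)` of a Koszul `1`-cochain. -/
def koszulVal (φ : (koszulComplex x).X 1 ⟶ M) (j : Fin n) : M :=
  φ.hom (koszulBasis R {j} (Finset.card_singleton j))

lemma koszulVal_injective {φ ψ : (koszulComplex x).X 1 ⟶ M}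
    (h : ∀ j, koszulVal φ j = koszulVal ψ j) : φ = ψ := by
  refine koszulX_hom_ext fun s hs => ?_
  obtain ⟨j, rfl⟩ := Finset.card_eq_one.1 hs
  exact h j

/-- The Koszul `1`-cochain with given values. -/
def koszulCochain (x : Fin n → R) (M : ModuleCat.{u} R) (f : Fin n → M) :
    (koszulComplex x).X 1 ⟶ M :=
  ModuleCat.ofHom ((∑ j, (LinearMap.toSpanSingleton R M (f j)) ∘ₗ Finsupp.lapply {j}) ∘ₗ
    (koszulX R n 1).subtype)

@[simp]
lemma koszulVal_koszulCochain (f : Fin n → M) (j : Fin n) :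
    koszulVal (koszulCochain x M f) j = f j := by
  change (∑ k, (LinearMap.toSpanSingleton R M (f k)) ∘ₗ Finsupp.lapply {k} :
    (Finset (Fin n) →₀ R) →ₗ[R] M) (Finsupp.single {j} 1) = f j
  rw [LinearMap.sum_apply, Finset.sum_eq_single j]
  · simp
  · intro k _ hk
    simp [Ne.symm hk]
  · simp

lemma koszulVal_d (ψ : (koszulComplex x).X 0 ⟶ M) (j : Fin n) :
    koszulVal ((koszulComplex x).d 1 0 ≫ ψ) j =
      x j • ψ.hom (koszulBasis R ∅ Finset.card_empty) := by
  rw [koszulComplex_d]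
  have : ((koszulD x).restrict fun _ hz => koszulD_mem (i := 0) x hz)
      (koszulBasis R {j} (Finset.card_singleton j)) = x j • koszulBasis R ∅ Finset.card_empty := by
    refine Subtype.ext ?_
    change koszulD x (Finsupp.single {j} 1) = x j • Finsupp.single ∅ 1
    rw [koszulD_single, Finset.sum_singleton]
    simp [koszulSign, Finset.filter_singleton]
  exact (congrArg ψ.hom this).trans (map_smul ψ.hom _ _)

lemma koszulD_pair {j k : Fin n} (h : j < k) (φ : (koszulComplex x).X 1 ⟶ M) :
    ((koszulComplex x).d 2 1 ≫ φ).hom (koszulBasis R {j, k} (Finset.card_pair h.ne)) =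
      x j • koszulVal φ k - x k • koszulVal φ j := by
  rw [koszulComplex_d]
  have : ((koszulD x).restrict fun _ hz => koszulD_mem (i := 1) x hz)
      (koszulBasis R {j, k} (Finset.card_pair h.ne)) =
      x j • koszulBasis R {k} (Finset.card_singleton k) -
        x k • koszulBasis R {j} (Finset.card_singleton j) := by
    refine Subtype.ext ?_
    change koszulD x (Finsupp.single {j, k} 1) = x j • Finsupp.single {k} 1 -
      x k • Finsupp.single {j} 1
    have h1 : ({j, k} : Finset (Fin n)).erase j = {k} := by
      rw [Finset.erase_insert]; simpa using h.ne
    have h2 : ({j, k} : Finset (Fin n)).erase k = {j} := by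
      rw [Finset.pair_comm, Finset.erase_insert]; simpa using h.ne'
    rw [koszulD_single, Finset.sum_pair h.ne, h1, h2]
    simp [koszulSign, Finset.filter_insert, Finset.filter_singleton, h, h.not_gt, sub_eq_add_neg]
  refine (congrArg φ.hom this).trans ((map_sub φ.hom _ _).trans ?_)
  exact congrArg₂ _ (map_smul φ.hom _ _) (map_smul φ.hom _ _)

lemma koszul_d_eq_zero_iff (φ : (koszulComplex x).X 1 ⟶ M) :
    (koszulComplex x).d 2 1 ≫ φ = 0 ↔ ∀ j k, x j • koszulVal φ k = x k • koszulVal φ j := by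
  constructor
  · intro h
    have key : ∀ j k, j < k → x j • koszulVal φ k = x k • koszulVal φ j := fun j k hjk => by
      rw [← sub_eq_zero, ← koszulD_pair hjk, h]; rfl
    intro j k
    rcases lt_trichotomy j k with hjk | rfl | hjk
    · exact key j k hjk
    · rfl
    · exact (key k j hjk).symm
  · intro h
    refine koszulX_hom_ext fun s hs => ?_
    obtain ⟨j, k, hjk, rfl⟩ := Finset.card_eq_two.1 hs
    rcases lt_or_gt_of_ne hjk with hlt | hlt
    · rw [koszulD_pair hlt, h, sub_self]; rfl
    -- The boundary formula is only available for an increasing pair, so the two indices are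
    -- swapped.
    · have : koszulBasis R {j, k} hs = koszulBasis R {k, j} (Finset.card_pair hlt.ne) :=
        Subtype.ext (congrArg (Finsupp.single · 1) (Finset.pair_comm j k))
      rw [this, koszulD_pair hlt, h, sub_self]; rfl

end KoszulCochains

/-! ### Classes in H^1_𝔪 represented by cocycles, and the vanishing of H^0_𝔪. -/

section LocalCohomologyClasses

open MvPolynomial

variable {K : Type u} [Field K] {n : ℕ} {M : ModuleCat.{u} (MvPolynomial (Fin n) K)}

/-- The values of a Koszul `1`-cocycle. -/
def cycleVal {t : ℕ} (c : (koszulCochains (varPow K n t) M).cycles 1) (j : Fin n) : M :=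
  koszulVal (x := varPow K n t) (((koszulCochains (varPow K n t) M).iCycles 1).hom c) j

lemma cycleVal_comm {t : ℕ} (c : (koszulCochains (varPow K n t) M).cycles 1) (j k : Fin n) :
    (X j ^ t : MvPolynomial (Fin n) K) • cycleVal c k =
      (X k ^ t : MvPolynomial (Fin n) K) • cycleVal c j :=
  (koszul_d_eq_zero_iff _).1 (cochainComplex_d_iCycles _ 1 2 c) j k

lemma exists_cycle {t : ℕ} (f : Fin n → M)
    (hf : ∀ j k, (X j ^ t : MvPolynomial (Fin n) K) • f k =
      (X k ^ t : MvPolynomial (Fin n) K) • f j) :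
    ∃ c : (koszulCochains (varPow K n t) M).cycles 1, ∀ j, cycleVal c j = f j := by
  obtain ⟨c, hc⟩ := cochainComplex_exists_cycle (koszulCochains (varPow K n t) M) 1
    (koszulCochain (varPow K n t) M f)
    ((koszul_d_eq_zero_iff _).2 fun j k => by
      rw [koszulVal_koszulCochain, koszulVal_koszulCochain]; exact hf j k)
  refine ⟨c, fun j => ?_⟩
  rw [cycleVal, hc, koszulVal_koszulCochain]

lemma cycleVal_injective {t : ℕ} {c c' : (koszulCochains (varPow K n t) M).cycles 1}
    (h : ∀ j, cycleVal c j = cycleVal c' j) : c = c' :=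
  cochainComplex_iCycles_injective _ _ (koszulVal_injective h)

lemma cycleVal_add {t : ℕ} (c c' : (koszulCochains (varPow K n t) M).cycles 1) (j : Fin n) :
    cycleVal (c + c') j = cycleVal c j + cycleVal c' j := by
  rw [cycleVal, map_add]; rfl

lemma cycleVal_smul {t : ℕ} (r : MvPolynomial (Fin n) K)
    (c : (koszulCochains (varPow K n t) M).cycles 1) (j : Fin n) :
    cycleVal (r • c) j = r • cycleVal c j := by
  rw [cycleVal, map_smul]
  rfl

lemma koszul_homologyπ_eq_zero_iff {t : ℕ} (c : (koszulCochains (varPow K n t) M).cycles 1) :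
    ((koszulCochains (varPow K n t) M).homologyπ 1).hom c = 0 ↔
      ∃ g : M, ∀ j, cycleVal c j = (X j ^ t : MvPolynomial (Fin n) K) • g := by
  rw [cochainComplex_homologyπ_eq_zero_iff]
  constructor
  · rintro ⟨ψ, hψ⟩
    refine ⟨ψ.hom (koszulBasis _ ∅ Finset.card_empty), fun j => ?_⟩
    rw [cycleVal, ← hψ]
    exact koszulVal_d ψ j
  · rintro ⟨g, hg⟩
    let ψ : (koszulComplex (varPow K n t)).X 0 ⟶ M :=
      ModuleCat.ofHom ((LinearMap.toSpanSingleton _ M g) ∘ₗ (Finsupp.lapply ∅) ∘ₗ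
        (koszulX (MvPolynomial (Fin n) K) n 0).subtype)
    have hψ : ψ.hom (koszulBasis _ ∅ Finset.card_empty) = g := by
      change (Finsupp.single ∅ (1 : MvPolynomial (Fin n) K) ∅) • g = g
      simp
    refine ⟨ψ, koszulVal_injective (x := varPow K n t) fun j => ?_⟩
    refine (koszulVal_d ψ j).trans ?_
    rw [hψ]
    exact (hg j).symm

/-- The chain map multiplies e_j by X_j^(t'-t), so the transition does the same to the j-th value of
a cocycle. -/
lemma koszulTransition_homologyπ {t t' : ℕ} (ht : t ≤ t')
    (c : (koszulCochains (varPow K n t) M).cycles 1) :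
    ∃ c' : (koszulCochains (varPow K n t') M).cycles 1,
      (∀ j, cycleVal c' j = (X j ^ (t' - t) : MvPolynomial (Fin n) K) • cycleVal c j) ∧
      (koszulTransition ht 1 M).hom (((koszulCochains (varPow K n t) M).homologyπ 1).hom c) =
        ((koszulCochains (varPow K n t') M).homologyπ 1).hom c' := by
  let α := linearYonedaObjMap (R := MvPolynomial (Fin n) K) (koszulPowMap K n ht) M
  refine ⟨(HomologicalComplex.cyclesMap α 1).hom c, fun j => ?_, ?_⟩
  · have h1 : ((koszulCochains (varPow K n t') M).iCycles 1).hom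
        ((HomologicalComplex.cyclesMap α 1).hom c) =
        (α.f 1).hom (((koszulCochains (varPow K n t) M).iCycles 1).hom c) :=
      congrArg (fun f => f.hom c) (HomologicalComplex.cyclesMap_i α 1)
    rw [cycleVal, h1]
    have h2 : ((koszulPowMap K n ht).f 1).hom (koszulBasis _ {j} (Finset.card_singleton j)) =
        (X j ^ (t' - t) : MvPolynomial (Fin n) K) •
          koszulBasis _ {j} (Finset.card_singleton j) := by
      refine Subtype.ext ?_
      change koszulScale (varPow K n (t' - t)) (Finsupp.single {j} 1) =
        (X j ^ (t' - t) : MvPolynomial (Fin n) K) • Finsupp.single {j} 1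
      rw [koszulScale_single, Finset.prod_singleton, Finsupp.smul_single]
      rfl
    exact (congrArg (ModuleCat.Hom.hom (((koszulCochains (varPow K n t) M).iCycles 1).hom c :
      (koszulComplex (varPow K n t)).X 1 ⟶ M)) h2).trans (map_smul _ _ _)
  · exact congrArg (fun f => f.hom c) (HomologicalComplex.homologyπ_naturality α 1)

/-- The class in `H^1_𝔪(M)` of a Koszul `1`-cocycle. -/
def cycleClass {t N : ℕ} (h : irrelevantIdeal K n ^ N ≤ varPowIdeal K n t) :
    (koszulCochains (varPow K n t) M).cycles 1 →ₗ[MvPolynomial (Fin n) K]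
      (localCohomology (irrelevantIdeal K n) 1).obj M :=
  (koszulToLocalCohomology t N h 1 M).hom ∘ₗ
    ((koszulCochains (varPow K n t) M).homologyπ 1).hom

lemma exists_cycleClass_eq (η : (localCohomology (irrelevantIdeal K n) 1).obj M) (t₀ : ℕ) :
    ∃ (t N : ℕ) (h : irrelevantIdeal K n ^ N ≤ varPowIdeal K n t)
      (c : (koszulCochains (varPow K n t) M).cycles 1), t₀ ≤ t ∧ cycleClass h c = η := by
  obtain ⟨t, N, h, z, ht, rfl⟩ := localCohomology_exists_koszul η t₀
  obtain ⟨c, rfl⟩ := cochainComplex_homologyπ_surjective _ _ z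
  exact ⟨t, N, h, c, ht, rfl⟩

lemma cycleClass_eq_of_cycleVal {t t' N N' : ℕ} (ht : t ≤ t')
    (h : irrelevantIdeal K n ^ N ≤ varPowIdeal K n t)
    (h' : irrelevantIdeal K n ^ N' ≤ varPowIdeal K n t')
    (c : (koszulCochains (varPow K n t) M).cycles 1)
    (c' : (koszulCochains (varPow K n t') M).cycles 1)
    (hc : ∀ j, cycleVal c' j = (X j ^ (t' - t) : MvPolynomial (Fin n) K) • cycleVal c j) :
    cycleClass h' c' = cycleClass h c := by
  obtain ⟨c'', hc'', e⟩ := koszulTransition_homologyπ ht c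
  obtain rfl : c' = c'' := cycleVal_injective fun j => (hc j).trans (hc'' j).symm
  refine (congrArg (koszulToLocalCohomology t' N' h' 1 M).hom e.symm).trans ?_
  exact congrArg (fun f => f.hom (((koszulCochains (varPow K n t) M).homologyπ 1).hom c))
    (koszulTransition_comp_koszulToLocalCohomology ht h h' 1 M)

/-- A class vanishes in the colimit iff its cocycle becomes a coboundary after raising the powers.
From here on no Ext or colimit has to be opened to test vanishing. -/
lemma cycleClass_eq_zero_iff {t N : ℕ} (h : irrelevantIdeal K n ^ N ≤ varPowIdeal K n t)
    (c : (koszulCochains (varPow K n t) M).cycles 1) :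
    cycleClass h c = 0 ↔ ∃ (t' : ℕ) (g : M), t ≤ t' ∧ ∀ j,
      (X j ^ (t' - t) : MvPolynomial (Fin n) K) • cycleVal c j =
        (X j ^ t' : MvPolynomial (Fin n) K) • g := by
  constructor
  · intro h0
    obtain ⟨t', ht, hz⟩ := koszulTransition_eq_zero_of_koszulToLocalCohomology_eq_zero (h := h)
      (((koszulCochains (varPow K n t) M).homologyπ 1).hom c) h0
    obtain ⟨c', hc', e⟩ := koszulTransition_homologyπ ht c
    rw [e, koszul_homologyπ_eq_zero_iff] at hz
    obtain ⟨g, hg⟩ := hz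
    exact ⟨t', g, ht, fun j => (hc' j).symm.trans (hg j)⟩
  · rintro ⟨t', g, ht, hg⟩
    obtain ⟨c', hc', -⟩ := koszulTransition_homologyπ ht c
    obtain ⟨N', h'⟩ := exists_irrelevantIdeal_pow_le (K := K) (n := n) t'
    rw [← cycleClass_eq_of_cycleVal ht h h' c c' hc']
    have := (koszul_homologyπ_eq_zero_iff c').2 ⟨g, fun j => (hc' j).trans (hg j)⟩
    exact (congrArg (koszulToLocalCohomology t' N' h' 1 M).hom this).trans (map_zero _)

/-- A Koszul 0-cocycle is an element killed by all X_j^t, and `hM` leaves only 0. -/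
lemma localCohomology_zero_eq_zero
    (hM : ∀ (t : ℕ) (m : M), (∀ j, (X j ^ t : MvPolynomial (Fin n) K) • m = 0) → m = 0)
    (η : (localCohomology (irrelevantIdeal K n) 0).obj M) : η = 0 := by
  obtain ⟨t, N, h, z, -, rfl⟩ := localCohomology_exists_koszul η 0
  obtain ⟨c, rfl⟩ := cochainComplex_homologyπ_surjective _ _ z
  suffices c = 0 by rw [this, map_zero, map_zero]
  refine cochainComplex_iCycles_injective _ _ ?_
  rw [map_zero]
  let φ : (koszulComplex (varPow K n t)).X 0 ⟶ M :=
    ((koszulCochains (varPow K n t) M).iCycles 0).hom c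
  have hφ : (koszulComplex (varPow K n t)).d 1 0 ≫ φ = 0 := cochainComplex_d_iCycles _ 0 1 c
  have h0 : φ.hom (koszulBasis _ ∅ Finset.card_empty) = 0 := by
    refine hM t _ fun j => ?_
    refine (koszulVal_d φ j).symm.trans ?_
    rw [hφ]
    rfl
  change φ = 0
  refine koszulX_hom_ext fun s hs => ?_
  obtain rfl := Finset.card_eq_zero.1 hs
  exact h0

end LocalCohomologyClasses

end

noncomputable section

/-! ### Coefficientwise analysis of I^2 and of its Koszul 1-cocycles. -/

section PathIdeal

open MvPolynomial

variable {K : Type u} [Field K]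

/-- The Stanley–Reisner ideal of the path on four points, by generators. -/
def pathIdeal (K : Type u) [Field K] : Ideal (MvPolynomial (Fin 4) K) :=
  Ideal.span {X 0 * X 2, X 0 * X 3, X 1 * X 3}

/-- The exponent vector `(1, 0, 0, 1)`. -/
def endsExponent : Fin 4 →₀ ℕ := Finsupp.single 0 1 + Finsupp.single 3 1

/-- `X^e` is not in the square of the prime ideal of the facet `{m, m + 1}`. -/
def FacetStandard (m : Fin 3) (e : Fin 4 →₀ ℕ) : Prop :=
  ![e 2 + e 3, e 0 + e 3, e 0 + e 1] m ≤ 1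

/-- This is the equality of I^2 with the intersection of the squares of the three facet primes. All
ideals involved are monomial, so it reduces to linear inequalities between exponents. -/
lemma mem_pathIdeal_sq_iff (p : MvPolynomial (Fin 4) K) :
    p ∈ pathIdeal K ^ 2 ↔ ∀ m e, FacetStandard m e → coeff e p = 0 := by
  let T : Set (Fin 4 →₀ ℕ) := {Finsupp.single 0 1 + Finsupp.single 2 1,
    Finsupp.single 0 1 + Finsupp.single 3 1, Finsupp.single 1 1 + Finsupp.single 3 1}
  have h1 : pathIdeal K = Ideal.span ((fun s => monomial s (1 : K)) '' T) := by
    simp only [pathIdeal, T, Set.image_insert_eq, Set.image_singleton, X, monomial_mul, one_mul]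
  have h2 : pathIdeal K ^ 2 =
      Ideal.span ((fun s => monomial s (1 : K)) '' (Set.image2 (· + ·) T T)) := by
    rw [pow_two, h1, Ideal.span_mul_span']
    congr 1
    ext q
    simp only [Set.mem_mul, Set.mem_image, Set.mem_image2]
    constructor
    · rintro ⟨_, ⟨u, hu, rfl⟩, _, ⟨v, hv, rfl⟩, rfl⟩
      exact ⟨_, ⟨u, hu, v, hv, rfl⟩, by simp [monomial_mul]⟩
    · rintro ⟨_, ⟨u, hu, v, hv, rfl⟩, rfl⟩
      exact ⟨_, ⟨u, hu, rfl⟩, _, ⟨v, hv, rfl⟩, by simp [monomial_mul]⟩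
  -- The combinatorial core: a product of two generators divides X^e iff e_2 + e_3, e_0 + e_3 and
  -- e_0 + e_1 are all at least 2.
  have h3 : ∀ e : Fin 4 →₀ ℕ, (∃ s ∈ Set.image2 (· + ·) T T, s ≤ e) ↔
      ∀ m, ¬ FacetStandard m e := by
    intro e
    simp only [T, Set.exists_mem_image2, Set.mem_insert_iff, Set.mem_singleton_iff,
      exists_eq_or_imp, exists_eq_left, Finsupp.le_def, Fin.forall_fin_succ, FacetStandard]
    simp [Finsupp.single_apply]
    omega
  rw [h2, mem_ideal_span_monomial_image]
  simp only [h3, mem_support_iff]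
  constructor
  · intro h m e he
    by_contra hne
    exact h e hne m he
  · intro h e hne m he
    exact hne (h m e he)

lemma coeff_X_pow_mul_of_le (j : Fin 4) (t : ℕ) (e : Fin 4 →₀ ℕ) (p : MvPolynomial (Fin 4) K) :
    coeff e (X j ^ t * p) = if t ≤ e j then coeff (e - Finsupp.single j t) p else 0 := by
  rw [X_pow_eq_monomial, coeff_monomial_mul']
  simp [Finsupp.single_le_iff]

lemma coeff_add_X_pow_mul (j : Fin 4) (t : ℕ) (e : Fin 4 →₀ ℕ) (p : MvPolynomial (Fin 4) K) :
    coeff (e + Finsupp.single j t) (X j ^ t * p) = coeff e p := by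
  rw [coeff_X_pow_mul_of_le, if_pos (by simp), add_tsub_cancel_right]

lemma exists_coeff_eq {σ R : Type*} [CommSemiring R] (c : (σ →₀ ℕ) → R) (s : Finset (σ →₀ ℕ))
    (hs : ∀ e, c e ≠ 0 → e ∈ s) : ∃ g : MvPolynomial σ R, ∀ e, coeff e g = c e := by
  classical
  refine ⟨∑ e ∈ s, monomial e (c e), fun e => ?_⟩
  rw [coeff_sum]
  simp only [coeff_monomial, Finset.sum_ite_eq']
  split_ifs with h
  · rfl
  · by_contra hne
    exact h (hs e (Ne.symm hne))

/-- The facet's own variables do not enter its condition, which is why they are nonzerodivisors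
modulo the square of its prime. -/
lemma FacetStandard.add_castSucc {m : Fin 3} {e : Fin 4 →₀ ℕ} (h : FacetStandard m e) (t : ℕ) :
    FacetStandard m (e + Finsupp.single m.castSucc t) := by
  fin_cases m <;> simpa [FacetStandard, Finsupp.single_apply] using h

lemma FacetStandard.add_succ {m : Fin 3} {e : Fin 4 →₀ ℕ} (h : FacetStandard m e) (t : ℕ) :
    FacetStandard m (e + Finsupp.single m.succ t) := by
  fin_cases m <;> simpa [FacetStandard, Finsupp.single_apply] using h

lemma FacetStandard.tsub {m : Fin 3} {e : Fin 4 →₀ ℕ} (h : FacetStandard m e) (d : Fin 4 →₀ ℕ) :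
    FacetStandard m (e - d) := by
  fin_cases m <;> simp [FacetStandard] at h ⊢ <;> omega

/-- From e_2 + e_3 ≤ 1, e_0 + e_1 ≤ 1 and e_0 + e_3 ≥ 2 there is no freedom left. This single
exponent accounts for all of H^1_𝔪. -/
lemma eq_endsExponent {e : Fin 4 →₀ ℕ} (h0 : FacetStandard 0 e) (h1 : ¬ FacetStandard 1 e)
    (h2 : FacetStandard 2 e) : e = endsExponent := by
  simp only [FacetStandard] at h0 h1 h2
  ext j
  fin_cases j <;> simp [endsExponent] at * <;> omega

/-- A family representing a Koszul `1`-cocycle of `S / I ^ 2`. -/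
def IsPathCocycle (t : ℕ) (p : Fin 4 → MvPolynomial (Fin 4) K) : Prop :=
  ∀ j k, X j ^ t * p k - X k ^ t * p j ∈ pathIdeal K ^ 2

lemma IsPathCocycle.coeff_eq {t : ℕ} {p : Fin 4 → MvPolynomial (Fin 4) K} (h : IsPathCocycle t p)
    {m : Fin 3} {e : Fin 4 →₀ ℕ} (he : FacetStandard m e) (j k : Fin 4) :
    coeff e (X j ^ t * p k) = coeff e (X k ^ t * p j) := by
  rw [← sub_eq_zero, ← coeff_sub]
  exact (mem_pathIdeal_sq_iff _).1 (h j k) m e he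

/-- The cocycle relation between X_m and X_{m+1} is read at X^e X_m^t X_{m+1}^t, which is still
standard. Both vertices of a facet thus propose the same coefficient for the quotient. -/
lemma IsPathCocycle.coeff_castSucc_eq_succ {t : ℕ} {p : Fin 4 → MvPolynomial (Fin 4) K}
    (h : IsPathCocycle t p) {m : Fin 3} {e : Fin 4 →₀ ℕ} (he : FacetStandard m e) :
    coeff (e + Finsupp.single m.castSucc t) (p m.castSucc) =
      coeff (e + Finsupp.single m.succ t) (p m.succ) := by
  rw [← coeff_add_X_pow_mul m.succ t, ← coeff_add_X_pow_mul m.castSucc t _ (p m.succ),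
    add_right_comm]
  exact (h.coeff_eq ((he.add_succ t).add_castSucc t) _ _)

/-- On one facet every cocycle is a coboundary: p_j is X_j^t times the quotient of p_m by X_m^t. -/
lemma IsPathCocycle.coeff_of_facetStandard {t : ℕ} {p : Fin 4 → MvPolynomial (Fin 4) K}
    (h : IsPathCocycle t p) {m : Fin 3} {e : Fin 4 →₀ ℕ} (he : FacetStandard m e) (j : Fin 4) :
    coeff e (p j) = if t ≤ e j then
      coeff (e - Finsupp.single j t + Finsupp.single m.castSucc t) (p m.castSucc) else 0 := by
  have key : ∀ i, i ≠ j → FacetStandard m (e + Finsupp.single i t) → coeff e (p j) =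
      if t ≤ e j then coeff (e - Finsupp.single j t + Finsupp.single i t) (p i) else 0 := by
    intro i hij hi
    rw [← coeff_add_X_pow_mul i t e, h.coeff_eq hi, coeff_X_pow_mul_of_le]
    have : (e + Finsupp.single i t) j = e j := by simp [hij]
    rw [this]
    split_ifs with ht
    · rw [tsub_add_eq_add_tsub (Finsupp.single_le_iff.2 ht)]
    · rfl
  -- The comparison needs a facet vertex different from j; for j = m the other vertex m + 1 is used.
  by_cases hj : m.castSucc = j
  · rw [key m.succ (fun hs => by rw [← hs] at hj; exact absurd hj (by simp [Fin.ext_iff]))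
      (he.add_succ t), h.coeff_castSucc_eq_succ (he.tsub _)]
  · exact key _ hj (he.add_castSucc t)

/-- The invariant which detects the nontrivial classes in the first local cohomology. -/
def pathInvariant (t : ℕ) (p : Fin 4 → MvPolynomial (Fin 4) K) : K :=
  coeff (endsExponent + Finsupp.single 0 t) (p 0) - coeff (endsExponent + Finsupp.single 3 t) (p 3)

/-- The quotients on the three facets are glued. Facets 0, 1 and facets 1, 2 agree through their
common vertex; for facets 0 and 2 only the exponent (1,0,0,1) is in doubt, and there `h0` gives
agreement. -/
lemma IsPathCocycle.exists_coboundary {t : ℕ} {p : Fin 4 → MvPolynomial (Fin 4) K}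
    (h : IsPathCocycle t p) (h0 : pathInvariant t p = 0) :
    ∃ g, ∀ j, p j - X j ^ t * g ∈ pathIdeal K ^ 2 := by
  classical
  let G : Fin 4 → (Fin 4 →₀ ℕ) → K := fun i e => coeff (e + Finsupp.single i t) (p i)
  -- The first facet for which e is standard decides. The default 0 is only reached when X^e lies in
  -- I^2.
  let c : (Fin 4 →₀ ℕ) → K := fun e => if FacetStandard 0 e then G 0 e else
    if FacetStandard 1 e then G 1 e else if FacetStandard 2 e then G 2 e else 0
  have hG : ∀ i e, G i e ≠ 0 → e ∈ ((p i).divMonomial (Finsupp.single i t)).support := by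
    intro i e he
    rwa [mem_support_iff, coeff_divMonomial, add_comm]
  obtain ⟨g, hg⟩ := exists_coeff_eq c
    (Finset.univ.biUnion fun i => ((p i).divMonomial (Finsupp.single i t)).support) (by
      intro e he
      rw [Finset.mem_biUnion]
      simp only [c] at he
      split_ifs at he
      · exact ⟨0, Finset.mem_univ _, hG _ _ he⟩
      · exact ⟨1, Finset.mem_univ _, hG _ _ he⟩
      · exact ⟨2, Finset.mem_univ _, hG _ _ he⟩
      · exact absurd rfl he)
  have g01 : ∀ e, FacetStandard 0 e → G 0 e = G 1 e := fun e he => h.coeff_castSucc_eq_succ he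
  have g12 : ∀ e, FacetStandard 1 e → G 1 e = G 2 e := fun e he => h.coeff_castSucc_eq_succ he
  have g23 : ∀ e, FacetStandard 2 e → G 2 e = G 3 e := fun e he => h.coeff_castSucc_eq_succ he
  have hc : ∀ m e, FacetStandard m e → c e = G m.castSucc e := by
    intro m e he
    simp only [c]
    fin_cases m
    · exact if_pos he
    · change FacetStandard 1 e at he
      change _ = G 1 e
      split_ifs with h0
      · exact g01 e h0
      · rfl
    · change FacetStandard 2 e at he
      change _ = G 2 e
      split_ifs with h0 h1
      · by_cases h1 : FacetStandard 1 e
        · rw [g01 e h0, g12 e h1]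
        -- The only use of the vanishing invariant.
        · rw [g23 e he, eq_endsExponent h0 h1 he]
          exact sub_eq_zero.1 ‹pathInvariant t p = 0›
      · exact g12 e h1
      · rfl
  refine ⟨g, fun j => (mem_pathIdeal_sq_iff _).2 fun m e he => ?_⟩
  rw [coeff_sub, h.coeff_of_facetStandard he, coeff_X_pow_mul_of_le, hg, hc m _ (he.tsub _),
    sub_self]

lemma facetStandard_ends_zero (t : ℕ) :
    FacetStandard 0 (endsExponent + Finsupp.single 0 t) := by
  simp [FacetStandard, endsExponent]

lemma facetStandard_ends_two (t : ℕ) :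
    FacetStandard 2 (endsExponent + Finsupp.single 3 t) := by
  simp [FacetStandard, endsExponent]

/-- The two coefficients are taken at monomials standard for facet 0 and for facet 2, so they do not
see I^2. -/
lemma pathInvariant_congr {t : ℕ} {p q : Fin 4 → MvPolynomial (Fin 4) K}
    (h : ∀ j, p j - q j ∈ pathIdeal K ^ 2) : pathInvariant t p = pathInvariant t q := by
  have h0 := (mem_pathIdeal_sq_iff _).1 (h 0) _ _ (facetStandard_ends_zero t)
  have h3 := (mem_pathIdeal_sq_iff _).1 (h 3) _ _ (facetStandard_ends_two t)
  rw [coeff_sub, sub_eq_zero] at h0 h3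
  rw [pathInvariant, h0, h3, pathInvariant]

lemma pathInvariant_X_pow_mul (t : ℕ) (g : MvPolynomial (Fin 4) K) :
    pathInvariant t (fun j => X j ^ t * g) = 0 := by
  rw [pathInvariant, coeff_add_X_pow_mul, coeff_add_X_pow_mul, sub_self]

lemma pathInvariant_shift (t s : ℕ) (p : Fin 4 → MvPolynomial (Fin 4) K) :
    pathInvariant (t + s) (fun j => X j ^ s * p j) = pathInvariant t p := by
  simp only [pathInvariant, Finsupp.single_add, ← add_assoc, coeff_add_X_pow_mul]

/-- A cocycle which generates the first local cohomology. -/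
def pathGenerator (K : Type u) [Field K] : Fin 4 → MvPolynomial (Fin 4) K :=
  ![X 0 ^ 2 * X 3, X 0 * X 1 * X 3, 0, 0]

/-- Modulo P_0^2 the family is X_j · X_0 X_3, and modulo P_1^2 and P_2^2 it is zero. It is the
failure of X_0 X_3 on facet 0 to glue with 0 on the other facets. -/
lemma isPathCocycle_pathGenerator : IsPathCocycle 1 (pathGenerator K) := by
  have h02 : (X 0 * X 2 : MvPolynomial (Fin 4) K) ∈ pathIdeal K :=
    Ideal.subset_span (by simp)
  have h03 : (X 0 * X 3 : MvPolynomial (Fin 4) K) ∈ pathIdeal K :=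
    Ideal.subset_span (by simp)
  have h13 : (X 1 * X 3 : MvPolynomial (Fin 4) K) ∈ pathIdeal K :=
    Ideal.subset_span (by simp)
  have key : ∀ {a b c : MvPolynomial (Fin 4) K}, a ∈ pathIdeal K → b ∈ pathIdeal K →
      c = a * b → c ∈ pathIdeal K ^ 2 ∧ -c ∈ pathIdeal K ^ 2 := by
    rintro a b c ha hb rfl
    have := Ideal.mul_mem_mul ha hb
    rw [← pow_two] at this
    exact ⟨this, neg_mem this⟩
  have k1 := key h02 h03 (c := X 2 * (X 0 ^ 2 * X 3)) (by ring)
  have k2 := key h03 h03 (c := X 3 * (X 0 ^ 2 * X 3)) (by ring)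
  have k3 := key h02 h13 (c := X 2 * (X 0 * X 1 * X 3)) (by ring)
  have k4 := key h03 h13 (c := X 3 * (X 0 * X 1 * X 3)) (by ring)
  have k5 : (X 0 * (X 0 * X 1 * X 3) - X 1 * (X 0 ^ 2 * X 3) : MvPolynomial (Fin 4) K) = 0 := by
    ring
  have k6 : (X 1 * (X 0 ^ 2 * X 3) - X 0 * (X 0 * X 1 * X 3) : MvPolynomial (Fin 4) K) = 0 := by
    ring
  intro j k
  fin_cases j <;> fin_cases k <;> simp [pathGenerator, k1, k2, k3, k4, k5, k6]

lemma pathInvariant_mul_pathGenerator (p : MvPolynomial (Fin 4) K) :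
    pathInvariant 1 (fun j => p * pathGenerator K j) = constantCoeff p := by
  have : (X 0 ^ 2 * X 3 : MvPolynomial (Fin 4) K) =
      monomial (endsExponent + Finsupp.single 0 1) 1 := by
    rw [X_pow_eq_monomial, X, monomial_mul, one_mul, endsExponent, add_right_comm,
      ← Finsupp.single_add]
  have h := coeff_mul_monomial 0 (endsExponent + Finsupp.single 0 1) (1 : K) p
  rw [zero_add] at h
  simp [pathInvariant, pathGenerator, this, h, constantCoeff_eq]

lemma pathInvariant_pathGenerator : pathInvariant 1 (pathGenerator K) = 1 := by
  simpa using pathInvariant_mul_pathGenerator (1 : MvPolynomial (Fin 4) K)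

end PathIdeal

end

noncomputable section

/-! ### H^1_𝔪(S/I^2) and its multigrading. -/

section PathLocalCohomology

open MvPolynomial

variable {K : Type u} [Field K]

/-- The ring `S / I ^ 2` as an `S`-module. -/
abbrev pathModule (K : Type u) [Field K] : ModuleCat.{u} (MvPolynomial (Fin 4) K) :=
  ModuleCat.of (MvPolynomial (Fin 4) K) (MvPolynomial (Fin 4) K ⧸ pathIdeal K ^ 2)

/-- The residue class map to `S / I ^ 2`. -/
def pathMk (K : Type u) [Field K] :
    MvPolynomial (Fin 4) K →ₗ[MvPolynomial (Fin 4) K] pathModule K :=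
  (pathIdeal K ^ 2).mkQ

lemma pathMk_surjective : Function.Surjective (pathMk K) :=
  Submodule.Quotient.mk_surjective _

lemma pathMk_eq_iff {p q : MvPolynomial (Fin 4) K} :
    pathMk K p = pathMk K q ↔ p - q ∈ pathIdeal K ^ 2 :=
  Submodule.Quotient.eq _

lemma smul_pathMk (p q : MvPolynomial (Fin 4) K) : p • pathMk K q = pathMk K (p * q) := rfl

lemma exists_lift {t : ℕ} (c : (koszulCochains (varPow K 4 t) (pathModule K)).cycles 1) :
    ∃ p : Fin 4 → MvPolynomial (Fin 4) K, ∀ j, cycleVal c j = pathMk K (p j) := by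
  choose p hp using fun j => pathMk_surjective (cycleVal c j)
  exact ⟨p, fun j => (hp j).symm⟩

lemma exists_cycle_of_isPathCocycle {t : ℕ} {p : Fin 4 → MvPolynomial (Fin 4) K}
    (hp : IsPathCocycle t p) :
    ∃ c : (koszulCochains (varPow K 4 t) (pathModule K)).cycles 1,
      ∀ j, cycleVal c j = pathMk K (p j) :=
  exists_cycle _ fun j k => by
    rw [smul_pathMk, smul_pathMk, pathMk_eq_iff]; exact hp j k

lemma IsPathCocycle.shift {t : ℕ} {p : Fin 4 → MvPolynomial (Fin 4) K} (h : IsPathCocycle t p)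
    (s : ℕ) : IsPathCocycle (t + s) (fun j => X j ^ s * p j) := by
  intro j k
  have : X j ^ (t + s) * (X k ^ s * p k) - X k ^ (t + s) * (X j ^ s * p j) =
      X j ^ s * X k ^ s * (X j ^ t * p k - X k ^ t * p j) := by ring
  rw [this]
  exact Ideal.mul_mem_left _ _ (h j k)

/-- The invariant is stable under transition and zero on coboundaries. Conversely, if it vanishes
the cocycle is a coboundary without raising the powers. -/
lemma cycleClass_eq_zero_iff_pathInvariant {t N : ℕ}
    (h : irrelevantIdeal K 4 ^ N ≤ varPowIdeal K 4 t)
    (c : (koszulCochains (varPow K 4 t) (pathModule K)).cycles 1)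
    {p : Fin 4 → MvPolynomial (Fin 4) K} (hp : ∀ j, cycleVal c j = pathMk K (p j)) :
    cycleClass h c = 0 ↔ pathInvariant t p = 0 := by
  rw [cycleClass_eq_zero_iff]
  constructor
  · rintro ⟨t', g, ht, hg⟩
    obtain ⟨g, rfl⟩ := pathMk_surjective g
    obtain ⟨s, rfl⟩ := Nat.exists_eq_add_of_le ht
    rw [← pathInvariant_shift t s, ← pathInvariant_X_pow_mul (t + s) g]
    refine pathInvariant_congr fun j => ?_
    rw [← pathMk_eq_iff, ← smul_pathMk, ← smul_pathMk, ← hp, ← hg, Nat.add_sub_cancel_left]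
  · intro h0
    have hc : IsPathCocycle t p := fun j k => by
      rw [← pathMk_eq_iff, ← smul_pathMk, ← smul_pathMk, ← hp, ← hp]
      exact cycleVal_comm c j k
    obtain ⟨g, hg⟩ := hc.exists_coboundary h0
    refine ⟨t, pathMk K g, le_rfl, fun j => ?_⟩
    rw [Nat.sub_self, pow_zero, one_smul, hp, smul_pathMk, pathMk_eq_iff]
    exact hg j

variable (K) in
/-- A cycle with values `pathGenerator`. -/
def pathCycle : (koszulCochains (varPow K 4 1) (pathModule K)).cycles 1 :=
  (exists_cycle_of_isPathCocycle isPathCocycle_pathGenerator).choose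

lemma cycleVal_pathCycle (j : Fin 4) : cycleVal (pathCycle K) j = pathMk K (pathGenerator K j) :=
  (exists_cycle_of_isPathCocycle isPathCocycle_pathGenerator).choose_spec j

variable (K) in
/-- The generator of `H^1_𝔪(S / I ^ 2)`. -/
def pathClass : (localCohomology (irrelevantIdeal K 4) 1).obj (pathModule K) :=
  cycleClass irrelevantIdeal_pow_one_le (pathCycle K)

lemma pathClass_ne_zero : pathClass K ≠ 0 := by
  rw [pathClass, Ne, cycleClass_eq_zero_iff_pathInvariant _ _ cycleVal_pathCycle,
    pathInvariant_pathGenerator]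
  exact one_ne_zero

lemma exists_C_smul_pathClass (η : (localCohomology (irrelevantIdeal K 4) 1).obj (pathModule K)) :
    ∃ r : K, (C r : MvPolynomial (Fin 4) K) • pathClass K = η := by
  -- The lower bound 1 allows the generator, which lives at t = 1, to be shifted to the same level
  -- as c; the scalar is then the invariant of c.
  obtain ⟨t, N, h, c, ht, rfl⟩ := exists_cycleClass_eq η 1
  obtain ⟨s, rfl⟩ := Nat.exists_eq_add_of_le ht
  obtain ⟨p, hp⟩ := exists_lift c
  obtain ⟨c₀, hc₀⟩ := exists_cycle_of_isPathCocycle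
    (isPathCocycle_pathGenerator (K := K).shift s)
  have e₀ : cycleClass h c₀ = pathClass K := by
    refine cycleClass_eq_of_cycleVal ht _ _ _ _ fun j => ?_
    rw [hc₀, cycleVal_pathCycle, smul_pathMk, Nat.add_sub_cancel_left]
  let r := pathInvariant (1 + s) p
  refine ⟨r, ?_⟩
  rw [← e₀, ← map_smul, ← sub_eq_zero, ← map_sub, sub_eq_add_neg, ← neg_one_smul
    (MvPolynomial (Fin 4) K) c]
  have hv : ∀ j, cycleVal ((C r : MvPolynomial (Fin 4) K) • c₀ +
      (-1 : MvPolynomial (Fin 4) K) • c) j =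
      pathMk K (C r * (X j ^ s * pathGenerator K j) - p j) := by
    intro j
    rw [cycleVal_add, cycleVal_smul, cycleVal_smul, hc₀, hp, smul_pathMk, smul_pathMk, ← map_add]
    congr 1
    ring
  rw [cycleClass_eq_zero_iff_pathInvariant _ _ hv]
  have h1 := pathInvariant_shift 1 s (pathGenerator K)
  rw [pathInvariant_pathGenerator, pathInvariant] at h1
  have hr : r = pathInvariant (1 + s) p := rfl
  rw [pathInvariant] at hr
  simp only [pathInvariant, coeff_sub, coeff_C_mul]
  linear_combination r * h1 + hr

/-- At t = 1 the cocycle relation X_j p_k = X_k p_j says that X_j p is the coboundary of p_j. -/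
lemma X_smul_pathClass (j : Fin 4) : (X j : MvPolynomial (Fin 4) K) • pathClass K = 0 := by
  rw [pathClass, ← map_smul, cycleClass_eq_zero_iff_pathInvariant _ _
    (p := fun k => X j * pathGenerator K k)
    (fun k => by rw [cycleVal_smul, cycleVal_pathCycle, smul_pathMk])]
  have hj := isPathCocycle_pathGenerator (K := K) j
  rw [← pathInvariant_X_pow_mul 1 (pathGenerator K j)]
  refine pathInvariant_congr fun k => ?_
  simpa using hj k

lemma irrelevantIdeal_isMaximal {n : ℕ} : (irrelevantIdeal K n).IsMaximal := by
  have : irrelevantIdeal K n = RingHom.ker (constantCoeff : MvPolynomial (Fin n) K →+* K) := by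
    refine le_antisymm (Ideal.span_le.2 ?_) fun p hp => ?_
    · rintro _ ⟨j, rfl⟩
      simp
    · have := (mem_ideal_span_X_image (s := Set.univ) (x := p)).2 fun m hm => by
        have hm0 : m ≠ 0 := by
          rintro rfl
          exact (mem_support_iff.1 hm) hp
        obtain ⟨i, hi⟩ := Finsupp.ne_iff.1 hm0
        exact ⟨i, Set.mem_univ _, hi⟩
      rwa [Set.image_univ] at this
  rw [this]
  exact RingHom.ker_isMaximal_of_surjective _ fun r => ⟨C r, constantCoeff_C _ r⟩

variable (K) in
/-- `H^1_𝔪(S / I ^ 2)` is isomorphic to `S / 𝔪`. -/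
lemma nonempty_localCohomology_equiv :
    Nonempty ((localCohomology (irrelevantIdeal K 4) 1).obj (pathModule K)
      ≃ₗ[MvPolynomial (Fin 4) K] (MvPolynomial (Fin 4) K ⧸ irrelevantIdeal K 4)) := by
  let f := LinearMap.toSpanSingleton (MvPolynomial (Fin 4) K) _ (pathClass K)
  have hs : Function.Surjective f := fun η => by
    obtain ⟨r, hr⟩ := exists_C_smul_pathClass η
    exact ⟨C r, hr⟩
  have hk : LinearMap.ker f = irrelevantIdeal K 4 := by
    refine (irrelevantIdeal_isMaximal.eq_of_le ?_ (Ideal.span_le.2 ?_)).symm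
    · intro h
      have : (1 : MvPolynomial (Fin 4) K) ∈ LinearMap.ker f := h ▸ Submodule.mem_top
      exact pathClass_ne_zero ((one_smul _ _).symm.trans this)
    · rintro _ ⟨j, rfl⟩
      exact X_smul_pathClass j
  exact ⟨(f.quotKerEquivOfSurjective hs).symm ≪≫ₗ Submodule.quotEquivOfEq _ _ hk⟩

variable (K) in
lemma finrank_localCohomologySpace :
    Module.finrank K (localCohomologySpace (pathIdeal K ^ 2) 1) = 1 :=
  finrank_eq_one (pathClass K : localCohomologySpace (pathIdeal K ^ 2) 1) pathClass_ne_zero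
    fun η => exists_C_smul_pathClass η

variable (K) in
lemma localCohomologyDegree_ends :
    localCohomologyDegree (pathIdeal K ^ 2) 1 ![1, 0, 0, 1] = ⊤ := by
  refine eq_top_iff.2 fun η _ => ?_
  obtain ⟨r, hr⟩ := exists_C_smul_pathClass η
  have hη : pathClass K ∈ localCohomologyDegree (pathIdeal K ^ 2) 1 ![1, 0, 0, 1] := by
    refine Submodule.subset_span ⟨1, 1, irrelevantIdeal_pow_one_le, pathCycle K, ?_, rfl⟩
    intro s hs
    obtain ⟨j, rfl⟩ := Finset.card_eq_one.1 hs
    have hj : pathMk K (pathGenerator K j) ∈ quotientDegree (pathIdeal K ^ 2)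
        fun k => (![1, 0, 0, 1] : Fin 4 → ℤ) k + if k ∈ ({j} : Finset (Fin 4)) then
          ((1 : ℕ) : ℤ) else 0 := by
      fin_cases j
      · refine Submodule.subset_span ⟨Finsupp.single 0 2 + Finsupp.single 3 1, ?_, ?_⟩
        · intro k; fin_cases k <;> simp
        · have : (X 0 ^ 2 * X 3 : MvPolynomial (Fin 4) K) =
              monomial (Finsupp.single 0 2 + Finsupp.single 3 1) 1 := by
            rw [X_pow_eq_monomial, X, monomial_mul, one_mul]
          exact congrArg (pathMk K) this
      · refine Submodule.subset_span ⟨Finsupp.single 0 1 + Finsupp.single 1 1 +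
          Finsupp.single 3 1, ?_, ?_⟩
        · intro k; fin_cases k <;> simp
        · simp [pathGenerator, X, monomial_mul]; rfl
      · change pathMk K 0 ∈ _
        rw [map_zero]; exact zero_mem _
      · change pathMk K 0 ∈ _
        rw [map_zero]; exact zero_mem _
    rw [← cycleVal_pathCycle] at hj
    exact hj
  rw [← hr]
  exact Submodule.smul_mem _ r hη

/-- A coefficient at a standard exponent is the same for all representatives, so one representative
without X^e suffices. -/
lemma coeff_eq_zero_of_mem_quotientDegree {b : Fin 4 → ℤ} {x : pathModule K}
    (hx : x ∈ quotientDegree (pathIdeal K ^ 2) b) {p : MvPolynomial (Fin 4) K}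
    (hp : x = pathMk K p) {m : Fin 3} {e : Fin 4 →₀ ℕ} (he : FacetStandard m e)
    (hb : ∃ j, (e j : ℤ) ≠ b j) : coeff e p = 0 := by
  suffices h : ∃ q, x = pathMk K q ∧ coeff e q = 0 by
    obtain ⟨q, hq, hq0⟩ := h
    have := (mem_pathIdeal_sq_iff _).1 (pathMk_eq_iff.1 (hp.symm.trans hq)) m e he
    rwa [coeff_sub, hq0, sub_zero] at this
  clear hp p
  obtain ⟨j, hj⟩ := hb
  induction hx using Submodule.span_induction with
  | mem x hx =>
    obtain ⟨e', he', rfl⟩ := hx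
    refine ⟨monomial e' 1, rfl, ?_⟩
    rw [coeff_monomial, if_neg]
    rintro rfl
    exact hj (he' j)
  | zero => exact ⟨0, (map_zero _).symm, coeff_zero _⟩
  | add x y _ _ hx hy =>
    obtain ⟨p, rfl, hp⟩ := hx
    obtain ⟨q, rfl, hq⟩ := hy
    exact ⟨p + q, (map_add _ _ _).symm, by rw [coeff_add, hp, hq, add_zero]⟩
  | smul r x _ hx =>
    obtain ⟨p, rfl, hp⟩ := hx
    exact ⟨C r * p, by rw [← smul_eq_C_mul]; rfl, by rw [coeff_C_mul, hp, mul_zero]⟩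

/-- Both coefficients in the invariant have degree (1,0,0,1) relative to their e_j, so they vanish
on a cocycle of any other degree. -/
lemma localCohomologyDegree_eq_bot {a : Fin 4 → ℤ} (ha : a ≠ ![1, 0, 0, 1]) :
    localCohomologyDegree (pathIdeal K ^ 2) 1 a = ⊥ := by
  refine eq_bot_iff.2 (Submodule.span_le.2 ?_)
  rintro _ ⟨t, N, h, c, hc, rfl⟩
  obtain ⟨p, hp⟩ := exists_lift c
  obtain ⟨k, hk⟩ := Function.ne_iff.1 ha
  have hw : ∀ k, (![1, 0, 0, 1] : Fin 4 → ℤ) k = endsExponent k := by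
    intro k; fin_cases k <;> simp [endsExponent]
  have hj : ∀ j, ∃ k, ((endsExponent + Finsupp.single j t : Fin 4 →₀ ℕ) k : ℤ) ≠
      a k + if k ∈ ({j} : Finset (Fin 4)) then (t : ℤ) else 0 := by
    intro j
    refine ⟨k, fun hkk => hk ?_⟩
    rw [hw]
    by_cases hjk : k = j
    · subst hjk; simpa using hkk.symm
    · simpa [hjk, Ne.symm hjk, Finsupp.single_apply] using hkk.symm
  have h0 := coeff_eq_zero_of_mem_quotientDegree (hc {0} rfl) (hp 0)
    (facetStandard_ends_zero t) (hj 0)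
  have h3 := coeff_eq_zero_of_mem_quotientDegree (hc {3} rfl) (hp 3)
    (facetStandard_ends_two t) (hj 3)
  refine (cycleClass_eq_zero_iff_pathInvariant h c hp).2 ?_
  rw [pathInvariant, h0, h3, sub_self]

end PathLocalCohomology

end

noncomputable section

/-! ### A Koszul bound on the depth. -/

section Depth

/-- If a Koszul `1`-cocycle with respect to generators of `I` is not a coboundary, then the
depth with respect to `I` is at most `1`. -/
lemma moduleDepth_le_one {R : Type*} [CommRing R] {M : Type*} [AddCommGroup M] [Module R M]
    {n : ℕ} (x : Fin n → R) (f : Fin n → M) (hf : ∀ j k, x j • f k = x k • f j)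
    (hne : ¬ ∃ g : M, ∀ j, f j = x j • g) :
    moduleDepth (Ideal.span (Set.range x)) M ≤ 1 := by
  refine iSup₂_le ?_
  rintro rs ⟨hrs, hreg⟩
  match rs, hrs, hreg with
  | [], _, _ => simp
  | [r], _, _ => simp
  | r₁ :: r₂ :: rs, hrs, hreg =>
    exfalso
    rw [RingTheory.Sequence.isRegular_cons_iff, RingTheory.Sequence.isRegular_cons_iff] at hreg
    obtain ⟨h₁, h₂, -⟩ := hreg
    obtain ⟨c, hc⟩ := Ideal.mem_span_range_iff_exists_fun.1 (hrs r₁ (by simp))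
    have hr₂ : r₂ ∈ Ideal.span (Set.range x) := hrs r₂ (by simp)
    -- Since x_k w = r₁ f_k, the class of w in M/r₁M is killed by the whole ideal, hence by the
    -- regular element r₂. So w = r₁ g, and cancelling r₁ gives f_k = x_k g.
    let w : M := ∑ j, c j • f j
    have hw : ∀ k, x k • w = r₁ • f k := by
      intro k
      rw [← hc, Finset.smul_sum, Finset.sum_smul]
      refine Finset.sum_congr rfl fun j _ => ?_
      rw [smul_comm, ← hf j k, smul_smul]
    have hmk : ∀ r ∈ Ideal.span (Set.range x),
        r • (Submodule.Quotient.mk w : QuotSMulTop r₁ M) = 0 := by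
      intro r hr
      obtain ⟨d, rfl⟩ := Ideal.mem_span_range_iff_exists_fun.1 hr
      rw [Finset.sum_smul]
      refine Finset.sum_eq_zero fun k _ => ?_
      rw [mul_smul, ← Submodule.Quotient.mk_smul, hw]
      have : (Submodule.Quotient.mk (r₁ • f k) : QuotSMulTop r₁ M) = 0 :=
        (Submodule.Quotient.mk_eq_zero _).2
          (Submodule.smul_mem_pointwise_smul _ _ _ Submodule.mem_top)
      rw [this, smul_zero]
    have hw0 : (Submodule.Quotient.mk w : QuotSMulTop r₁ M) = 0 :=
      h₂ ((hmk r₂ hr₂).trans (smul_zero _).symm)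
    rw [Submodule.Quotient.mk_eq_zero, Submodule.mem_smul_pointwise_iff_exists] at hw0
    obtain ⟨g, -, hg⟩ := hw0
    refine hne ⟨g, fun k => h₁ ?_⟩
    change r₁ • f k = r₁ • x k • g
    rw [← hw, ← hg, smul_comm]

end Depth

/-! ### Depth, dimension, Buchsbaumness and the Stanley–Reisner description. -/

section PathRing

open MvPolynomial

variable {K : Type u} [Field K]

variable (K) in
/-- The ring `S / I ^ 2`. -/
abbrev PathRing : Type u := MvPolynomial (Fin 4) K ⧸ pathIdeal K ^ 2

/-- Every facet contains vertex 1 or 2. On a facet containing one of them, say i, the coefficients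
of p vanish by induction on the exponent of the other variable j, because X_i acts injectively and
X_j p only involves coefficients with a smaller exponent of X_j. -/
lemma isSMulRegular_X_one_add_X_two :
    IsSMulRegular (PathRing K) (X 1 + X 2 : MvPolynomial (Fin 4) K) := by
  rw [isSMulRegular_iff_right_eq_zero_of_smul]
  intro x hx
  obtain ⟨p, rfl⟩ := Ideal.Quotient.mk_surjective x
  have hx' : (X 1 + X 2) * p ∈ pathIdeal K ^ 2 := Ideal.Quotient.eq_zero_iff_mem.1 hx
  have h : ∀ m e, FacetStandard m e → coeff e (X 1 ^ 1 * p) + coeff e (X 2 ^ 1 * p) = 0 := by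
    intro m e he
    rw [← coeff_add, pow_one, pow_one, ← add_mul]
    exact (mem_pathIdeal_sq_iff _).1 hx' m e he
  have main : ∀ (i j : Fin 4), i ≠ j →
      (∀ e m, FacetStandard m e → coeff e (X i ^ 1 * p) + coeff e (X j ^ 1 * p) = 0) →
      ∀ m, (∀ e, FacetStandard m e → FacetStandard m (e + Finsupp.single i 1)) →
      ∀ d e, e j = d → FacetStandard m e → coeff e p = 0 := by
    intro i j hij h m hi d
    induction d with
    | zero =>
      intro e hd he
      have := h _ _ (hi e he)
      rw [coeff_add_X_pow_mul, coeff_X_pow_mul_of_le, if_neg (by simp [hij, hd])] at this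
      simpa using this
    | succ d ih =>
      intro e hd he
      have := h _ _ (hi e he)
      rw [coeff_add_X_pow_mul, coeff_X_pow_mul_of_le, if_pos (by simp [hij, hd]),
        ih _ (by simp [hij, hd]) ((hi e he).tsub _), add_zero] at this
      exact this
  have h12 := main 1 2 (by decide) fun e m he => h m e he
  have h21 := main 2 1 (by decide) fun e m he => by rw [add_comm]; exact h m e he
  refine Ideal.Quotient.eq_zero_iff_mem.2 ((mem_pathIdeal_sq_iff _).2 fun m e he => ?_)
  fin_cases m
  · exact h12 0 (fun e he => he.add_succ 1) _ e rfl he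
  · exact h12 1 (fun e he => he.add_castSucc 1) _ e rfl he
  · exact h21 2 (fun e he => he.add_castSucc 1) _ e rfl he

lemma pathIdeal_sq_le_ker_constantCoeff :
    ∀ p ∈ pathIdeal K ^ 2, constantCoeff p = 0 := fun p hp =>
  (mem_pathIdeal_sq_iff p).1 hp 0 0 (by simp [FacetStandard])

variable (K) in
/-- The augmentation `S / I ^ 2 → K`. -/
def pathAug : PathRing K →+* K :=
  Ideal.Quotient.lift _ constantCoeff pathIdeal_sq_le_ker_constantCoeff

lemma moduleDepth_pathRing : moduleDepth (irrelevantIdeal K 4) (PathRing K) = 1 := by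
  refine le_antisymm ?_ ?_
  · refine moduleDepth_le_one X (fun j => pathMk K (pathGenerator K j)) (fun j k => ?_) ?_
    · have := isPathCocycle_pathGenerator (K := K) j k
      rw [pow_one, pow_one] at this
      exact pathMk_eq_iff.2 this
    · rintro ⟨g, hg⟩
      obtain ⟨g, rfl⟩ := pathMk_surjective g
      have h1 : pathInvariant 1 (pathGenerator K) = pathInvariant 1 fun j => X j ^ 1 * g :=
        pathInvariant_congr fun j => by
          rw [pow_one]; exact pathMk_eq_iff.1 (hg j)
      rw [pathInvariant_pathGenerator, pathInvariant_X_pow_mul] at h1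
      exact one_ne_zero h1
  · refine le_iSup₂_of_le [X 1 + X 2] ⟨?_, ?_⟩ (by simp)
    · intro r hr
      rw [List.mem_singleton] at hr
      subst hr
      exact add_mem (Ideal.subset_span ⟨1, rfl⟩) (Ideal.subset_span ⟨2, rfl⟩)
    · refine ⟨(RingTheory.Sequence.isWeaklyRegular_cons_iff _ _ _).2
        ⟨isSMulRegular_X_one_add_X_two, RingTheory.Sequence.IsWeaklyRegular.nil _ _⟩, ?_⟩
      -- The quotient by X_1 + X_2 is nonzero, because the augmentation to K kills X_1 + X_2 but not
      -- 1.
      intro h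
      have h1 : (1 : PathRing K) ∈ (⊤ : Submodule (MvPolynomial (Fin 4) K) (PathRing K)) :=
        Submodule.mem_top
      rw [h, Ideal.ofList_singleton, Submodule.ideal_span_singleton_smul,
        Submodule.mem_smul_pointwise_iff_exists] at h1
      obtain ⟨y, -, hy⟩ := h1
      have h2 : pathAug K ((Ideal.Quotient.mk _ (X 1 + X 2)) * y) = 1 := by
        rw [← map_one (pathAug K), ← hy]; rfl
      have h3 : pathAug K (Ideal.Quotient.mk _ (X 1 + X 2)) = 0 := by simp [pathAug]
      rw [map_mul, h3, zero_mul] at h2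
      exact zero_ne_one h2

lemma ringKrullDim_quotient_span_pair_le {i j k l : Fin 4}
    (h : ∀ v, v = i ∨ v = j ∨ v = k ∨ v = l) :
    ringKrullDim (MvPolynomial (Fin 4) K ⧸ Ideal.span {(X i : MvPolynomial (Fin 4) K), X j}) ≤
      2 := by
  let J := Ideal.span {(X i : MvPolynomial (Fin 4) K), X j}
  let φ : MvPolynomial (Fin 2) K →ₐ[K] MvPolynomial (Fin 4) K ⧸ J :=
    aeval ![Ideal.Quotient.mk J (X k), Ideal.Quotient.mk J (X l)]
  have hX : ∀ v, Ideal.Quotient.mkₐ K J (X v) ∈ φ.range := by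
    intro v
    rcases h v with rfl | rfl | rfl | rfl
    · have : Ideal.Quotient.mkₐ K J (X v) = 0 :=
        Ideal.Quotient.eq_zero_iff_mem.2 (Ideal.subset_span (by simp))
      rw [this]; exact zero_mem _
    · have : Ideal.Quotient.mkₐ K J (X v) = 0 :=
        Ideal.Quotient.eq_zero_iff_mem.2 (Ideal.subset_span (by simp))
      rw [this]; exact zero_mem _
    · exact ⟨X 0, by simp [φ]⟩
    · exact ⟨X 1, by simp [φ]⟩
  have hφ : Function.Surjective φ := by
    rw [← AlgHom.range_eq_top, eq_top_iff]
    have : (Ideal.Quotient.mkₐ K J).range ≤ φ.range := by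
      rw [← Algebra.map_top, ← adjoin_range_X, AlgHom.map_adjoin, Algebra.adjoin_le_iff]
      rintro _ ⟨_, ⟨v, rfl⟩, rfl⟩
      exact hX v
    rwa [(AlgHom.range_eq_top _).2 (Ideal.Quotient.mkₐ_surjective K J)] at this
  refine (ringKrullDim_le_of_surjective φ.toRingHom hφ).trans ?_
  rw [ringKrullDim_of_isNoetherianRing, ringKrullDim_eq_zero_of_field]
  simp

/-- The smallest prime of a chain contains I, hence two of the variables, so the whole chain lives
in a quotient of a polynomial ring in two variables. -/
lemma ringKrullDim_pathRing_le : ringKrullDim (PathRing K) ≤ 2 := by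
  rw [ringKrullDim_quotient]
  refine iSup_le fun s => ?_
  let Q := s.head.1
  have hQ : pathIdeal K ≤ Q.asIdeal := by
    have : pathIdeal K ^ 2 ≤ Q.asIdeal := s.head.2
    exact Ideal.IsPrime.le_of_pow_le this
  have key : ∀ i j k l : Fin 4, (∀ v, v = i ∨ v = j ∨ v = k ∨ v = l) →
      X i ∈ Q.asIdeal → X j ∈ Q.asIdeal → (s.length : WithBot ℕ∞) ≤ 2 := by
    intro i j k l h hi hj
    refine le_trans ?_ (ringKrullDim_quotient_span_pair_le (K := K) h)
    rw [ringKrullDim_quotient]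
    let s' : LTSeries (PrimeSpectrum.zeroLocus
        (Ideal.span {(X i : MvPolynomial (Fin 4) K), X j} : Set (MvPolynomial (Fin 4) K))) :=
      ⟨s.length, fun a => ⟨(s a).1, by
        rw [PrimeSpectrum.mem_zeroLocus, SetLike.coe_subset_coe, Ideal.span_le]
        have hle : Q.asIdeal ≤ (s a).1.asIdeal := s.monotone (Fin.zero_le a)
        rintro p (rfl | rfl)
        · exact hle hi
        · exact hle hj⟩, fun a => s.step a⟩
    exact le_iSup (fun p : LTSeries _ => (p.length : WithBot ℕ∞)) s'
  have h02 : X 0 ∈ Q.asIdeal ∨ X 2 ∈ Q.asIdeal :=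
    Q.2.mem_or_mem (hQ (Ideal.subset_span (by simp)))
  have h03 : X 0 ∈ Q.asIdeal ∨ X 3 ∈ Q.asIdeal :=
    Q.2.mem_or_mem (hQ (Ideal.subset_span (by simp)))
  have h13 : X 1 ∈ Q.asIdeal ∨ X 3 ∈ Q.asIdeal :=
    Q.2.mem_or_mem (hQ (Ideal.subset_span (by simp)))
  rcases h03 with h0 | h3
  · rcases h13 with h1 | h3
    · exact key 0 1 2 3 (by decide) h0 h1
    · exact key 0 3 1 2 (by decide) h0 h3
  · rcases h02 with h0 | h2
    · exact key 0 3 1 2 (by decide) h0 h3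
    · exact key 2 3 0 1 (by decide) h2 h3

variable (K) in
/-- The ring homomorphism which kills the variables outside `s ⊆ {0, 1}`. -/
def pathRestrict (s : Finset (Fin 4)) (hs : s ⊆ {0, 1}) : PathRing K →+* MvPolynomial (Fin 4) K :=
  Ideal.Quotient.lift _ (aeval fun j => if j ∈ s then X j else 0 :
    MvPolynomial (Fin 4) K →ₐ[K] MvPolynomial (Fin 4) K).toRingHom fun p hp => by
    have h2 : (2 : Fin 4) ∉ s := fun h => absurd (hs h) (by decide)
    have h3 : (3 : Fin 4) ∉ s := fun h => absurd (hs h) (by decide)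
    have hle : pathIdeal K ≤ RingHom.ker (aeval fun j => if j ∈ s then X j else 0 :
        MvPolynomial (Fin 4) K →ₐ[K] MvPolynomial (Fin 4) K) := by
      refine Ideal.span_le.2 ?_
      rintro q (rfl | rfl | rfl) <;> simp [h2, h3]
    exact hle (Ideal.pow_le_self two_ne_zero hp)

lemma pathRestrict_mk_X (s : Finset (Fin 4)) (hs : s ⊆ {0, 1}) (j : Fin 4) :
    pathRestrict K s hs (Ideal.Quotient.mk _ (X j)) = if j ∈ s then X j else 0 := by
  change aeval _ (X j) = _
  rw [aeval_X]

lemma ker_pathRestrict_le {s s' : Finset (Fin 4)} (hs : s ⊆ {0, 1}) (h : s' ⊆ s) :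
    RingHom.ker (pathRestrict K s hs) ≤ RingHom.ker (pathRestrict K s' (h.trans hs)) := by
  intro x hx
  obtain ⟨p, rfl⟩ := Ideal.Quotient.mk_surjective x
  rw [RingHom.mem_ker] at hx ⊢
  let φ : Finset (Fin 4) → MvPolynomial (Fin 4) K →ₐ[K] MvPolynomial (Fin 4) K := fun s =>
    aeval fun j => if j ∈ s then X j else 0
  have hφ : (φ s').comp (φ s) = φ s' := by
    refine MvPolynomial.algHom_ext fun j => ?_
    simp only [φ, AlgHom.comp_apply, aeval_X]
    by_cases hj : j ∈ s
    · simp [hj]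
    · simp [hj, show j ∉ s' from fun h' => hj (h h')]
  have hp : φ s p = 0 := hx
  change φ s' p = 0
  rw [← hφ, AlgHom.comp_apply, hp, map_zero]

lemma ker_pathRestrict_lt {s s' : Finset (Fin 4)} (hs : s ⊆ {0, 1}) (h : s' ⊂ s) :
    RingHom.ker (pathRestrict K s hs) < RingHom.ker (pathRestrict K s' (h.subset.trans hs)) := by
  refine lt_of_le_of_ne (ker_pathRestrict_le hs h.subset) fun heq => ?_
  obtain ⟨j, hj, hj'⟩ := Finset.exists_of_ssubset h
  have h1 : Ideal.Quotient.mk _ (X j) ∈ RingHom.ker (pathRestrict K s' (h.subset.trans hs)) := by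
    rw [RingHom.mem_ker, pathRestrict_mk_X, if_neg hj']
  rw [← heq, RingHom.mem_ker, pathRestrict_mk_X, if_pos hj] at h1
  exact X_ne_zero j h1

lemma ker_pathAug : RingHom.ker (pathAug K) =
    RingHom.ker (pathRestrict K ∅ (Finset.empty_subset _)) := by
  ext x
  obtain ⟨p, rfl⟩ := Ideal.Quotient.mk_surjective x
  have h : pathRestrict K ∅ (Finset.empty_subset _) (Ideal.Quotient.mk _ p) =
      C (constantCoeff p) := by
    change aeval (fun _ => (0 : MvPolynomial (Fin 4) K)) p = _
    exact aeval_zero' p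
  rw [RingHom.mem_ker, RingHom.mem_ker, h]
  simp [pathAug]

instance : (RingHom.ker (pathAug K)).IsPrime := RingHom.ker_isPrime _

/-- Restricting to the vertex sets {0,1}, {0} and ∅ gives a strict chain of three primes ending at
the homogeneous maximal ideal. -/
lemma two_le_height_ker_pathAug : 2 ≤ (RingHom.ker (pathAug K)).height := by
  have hp : ∀ s hs, (RingHom.ker (pathRestrict K s hs)).IsPrime := fun s hs =>
    RingHom.ker_isPrime _
  have h0 : ({0} : Finset (Fin 4)) ⊆ {0, 1} := by decide
  have := hp {0, 1} subset_rfl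
  have := hp {0} h0
  have := hp ∅ (by decide)
  have h1 := Ideal.height_strict_mono_of_isPrime
    (ker_pathRestrict_lt (K := K) (s := {0, 1}) (s' := {0}) subset_rfl (by decide))
  have h2 := Ideal.height_strict_mono_of_isPrime
    (ker_pathRestrict_lt (K := K) h0 Finset.empty_ssubset_singleton)
  rw [ker_pathAug]
  have h3 := Order.add_one_le_of_lt (lt_of_le_of_lt (Order.add_one_le_of_lt h1) h2)
  refine le_trans ?_ h3
  rw [add_assoc, one_add_one_eq_two]
  exact le_add_self

lemma ringKrullDim_pathRing : ringKrullDim (PathRing K) = 2 := by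
  refine le_antisymm ringKrullDim_pathRing_le ?_
  refine le_trans ?_ (Ideal.height_le_ringKrullDim_of_isPrime (I := RingHom.ker (pathAug K)))
  exact WithBot.coe_le_coe.2 two_le_height_ker_pathAug

lemma irrelevantIdeal_eq_ker {n : ℕ} :
    irrelevantIdeal K n = RingHom.ker (constantCoeff : MvPolynomial (Fin n) K →+* K) :=
  irrelevantIdeal_isMaximal.eq_of_le (RingHom.ker_ne_top _) (Ideal.span_le.2 (by
    rintro _ ⟨j, rfl⟩
    simp))

lemma ker_pathAug_eq_span :
    RingHom.ker (pathAug K) = Ideal.span (Set.range fun j => Ideal.Quotient.mk _ (X j)) := by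
  refine le_antisymm (fun x hx => ?_) (Ideal.span_le.2 ?_)
  · obtain ⟨p, rfl⟩ := Ideal.Quotient.mk_surjective x
    have hp : p ∈ irrelevantIdeal K 4 := by
      rw [irrelevantIdeal_eq_ker]; exact hx
    have := Ideal.mem_map_of_mem (Ideal.Quotient.mk (pathIdeal K ^ 2)) hp
    rw [irrelevantIdeal, Ideal.map_span, ← Set.range_comp] at this
    exact this
  · rintro _ ⟨j, rfl⟩
    simp [pathAug]

/-- The generating cocycle stays nontrivial after localization. Clearing denominators in a
coboundary relation would give p · generator = X_j q modulo I^2 with p outside 𝔪, whereas comparing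
invariants makes the constant coefficient of p zero. -/
lemma moduleDepth_localization_le_one :
    moduleDepth (R := Localization.AtPrime (RingHom.ker (pathAug K)))
      (IsLocalRing.maximalIdeal (Localization.AtPrime (RingHom.ker (pathAug K))))
      (Localization.AtPrime (RingHom.ker (pathAug K))) ≤ 1 := by
  let P := RingHom.ker (pathAug K)
  let mk := Ideal.Quotient.mk (pathIdeal K ^ 2)
  let ι := algebraMap (PathRing K) (Localization.AtPrime P)
  have hm : IsLocalRing.maximalIdeal (Localization.AtPrime P) =
      Ideal.span (Set.range fun j => ι (mk (X j))) := by
    rw [← Localization.AtPrime.map_eq_maximalIdeal]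
    change Ideal.map ι (RingHom.ker (pathAug K)) = _
    rw [ker_pathAug_eq_span, Ideal.map_span, ← Set.range_comp]
    rfl
  rw [hm]
  refine moduleDepth_le_one _ (fun j => ι (mk (pathGenerator K j))) (fun j k => ?_) ?_
  · have h := isPathCocycle_pathGenerator (K := K) j k
    rw [pow_one, pow_one] at h
    have h' : mk (X j * pathGenerator K k) = mk (X k * pathGenerator K j) := Ideal.Quotient.eq.2 h
    rw [smul_eq_mul, smul_eq_mul, ← map_mul, ← map_mul, ← map_mul, ← map_mul, h']
  · rintro ⟨g, hg⟩
    obtain ⟨⟨a, s⟩, has⟩ := IsLocalization.surj P.primeCompl g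
    have h1 : ∀ j, ∃ u : P.primeCompl,
        (u : PathRing K) * (s * mk (pathGenerator K j)) = u * (mk (X j) * a) := by
      intro j
      refine (IsLocalization.eq_iff_exists P.primeCompl (Localization.AtPrime P)).1 ?_
      have hgj : ι (mk (pathGenerator K j)) = ι (mk (X j)) * g := hg j
      change ι _ = ι _
      change g * ι s = ι a at has
      rw [map_mul, map_mul, hgj, ← has]
      ring
    choose u hu using h1
    -- A common multiplier turns the four separate equalities into simultaneous ones.
    let v : P.primeCompl := ∏ j, u j
    have hv : ∀ j, ((v * s : P.primeCompl) : PathRing K) * mk (pathGenerator K j) =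
        mk (X j) * (v * a) := by
      intro j
      have hvj : (v : PathRing K) = u j * ((∏ k ∈ Finset.univ.erase j, u k : P.primeCompl) :
          PathRing K) := by
        rw [← Submonoid.coe_mul, Finset.mul_prod_erase _ _ (Finset.mem_univ j)]
      rw [Submonoid.coe_mul, hvj]
      linear_combination ((∏ k ∈ Finset.univ.erase j, u k : P.primeCompl) : PathRing K) * hu j
    obtain ⟨p, hp⟩ := Ideal.Quotient.mk_surjective ((v * s : P.primeCompl) : PathRing K)
    obtain ⟨q, hq⟩ := Ideal.Quotient.mk_surjective ((v : PathRing K) * a)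
    have h2 : pathInvariant 1 (fun j => p * pathGenerator K j) =
        pathInvariant 1 fun j => X j ^ 1 * q := by
      refine pathInvariant_congr fun j => Ideal.Quotient.eq.1 ?_
      rw [map_mul, map_mul, pow_one, hp, hq]
      exact hv j
    rw [pathInvariant_mul_pathGenerator, pathInvariant_X_pow_mul] at h2
    refine (v * s).2 ?_
    rw [← hp]
    exact h2

lemma not_isCohenMacaulayRing_pathRing : ¬ IsCohenMacaulayRing (PathRing K) := by
  rintro ⟨-, h⟩
  have h1 := h (RingHom.ker (pathAug K))
  rw [IsLocalization.AtPrime.ringKrullDim_eq_height (RingHom.ker (pathAug K))] at h1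
  have h2 := WithBot.coe_inj.1 h1
  have h3 := two_le_height_ker_pathAug (K := K)
  rw [← h2] at h3
  exact absurd (h3.trans moduleDepth_localization_le_one) (by decide)

lemma isBuchsbaumQuotient_pathIdeal_sq : IsBuchsbaumQuotient (pathIdeal K ^ 2) := by
  intro i hi η
  rw [ringKrullDim_pathRing] at hi
  have hi' : i < 2 := by exact_mod_cast hi
  interval_cases i
  -- Nothing is killed by powers of all the variables, since on facet m the variable X_m is already
  -- a nonzerodivisor.
  · have h0 : ∀ η : (localCohomology (irrelevantIdeal K 4) 0).obj (pathModule K), η = 0 := by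
      refine localCohomology_zero_eq_zero fun t x hx => ?_
      obtain ⟨p, rfl⟩ := pathMk_surjective x
      rw [← map_zero (pathMk K), pathMk_eq_iff, sub_zero, mem_pathIdeal_sq_iff]
      intro m e he
      have h1 := hx m.castSucc
      rw [smul_pathMk, ← map_zero (pathMk K), pathMk_eq_iff, sub_zero, mem_pathIdeal_sq_iff] at h1
      rw [← coeff_add_X_pow_mul m.castSucc t]
      exact h1 m _ (he.add_castSucc t)
    exact ⟨0, (map_zero _).trans (h0 η).symm⟩
  -- All of H^1_𝔪 is spanned by the class of a cocycle at t = 1, hence lies in the image of Koszul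
  -- cohomology of the variables themselves.
  · obtain ⟨r, hr⟩ := exists_C_smul_pathClass η
    refine ⟨((koszulCochains (varPow K 4 1) (pathModule K)).homologyπ 1).hom
      ((C r : MvPolynomial (Fin 4) K) • pathCycle K), ?_⟩
    rw [← hr, pathClass, ← map_smul]
    rfl

/-- The minimal nonfaces are the three pairs of non-neighbours, and every nonempty nonface contains
one of them. -/
lemma pathIdeal_eq_stanleyReisnerIdeal : pathIdeal K = stanleyReisnerIdeal K (pathComplex 4) := by
  have hmem : ∀ F : Finset (Fin 4), F ∈ pathComplex 4 ↔
      F.Nonempty ∧ ∃ i : ℕ, ∀ v ∈ F, (v : ℕ) = i ∨ (v : ℕ) = i + 1 := fun F => Iff.rfl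
  refine le_antisymm (Ideal.span_le.2 ?_) (Ideal.span_le.2 ?_)
  · have key : ∀ i j : Fin 4, (i : ℕ) + 1 < j →
        (X i * X j : MvPolynomial (Fin 4) K) ∈ stanleyReisnerIdeal K (pathComplex 4) := by
      intro i j hij
      have hne : i ≠ j := fun h => by subst h; omega
      refine Ideal.subset_span ⟨{i, j}, by simp, ?_, (Finset.prod_pair hne).symm⟩
      rw [hmem]
      rintro ⟨-, k, hk⟩
      have h1 := hk i (by simp)
      have h2 := hk j (by simp)
      omega
    rintro p (rfl | rfl | rfl)
    · exact key 0 2 (by decide)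
    · exact key 0 3 (by decide)
    · exact key 1 3 (by decide)
  · rintro p ⟨F, hF, hnF, rfl⟩
    have key : ∀ i j : Fin 4, i ≠ j → (X i * X j : MvPolynomial (Fin 4) K) ∈ pathIdeal K →
        i ∈ F → j ∈ F → ∏ i ∈ F, (X i : MvPolynomial (Fin 4) K) ∈ pathIdeal K := by
      intro i j hij h hi hj
      refine Ideal.mem_of_dvd _ ?_ h
      rw [← Finset.prod_pair hij]
      exact Finset.prod_dvd_prod_of_subset _ _ _ (by
        intro k hk
        rcases Finset.mem_insert.1 hk with rfl | hk
        · exact hi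
        · rw [Finset.mem_singleton.1 hk]; exact hj)
    have hdec : (0 ∈ F ∧ 2 ∈ F) ∨ (0 ∈ F ∧ 3 ∈ F) ∨ (1 ∈ F ∧ 3 ∈ F) := by
      by_contra hcon
      -- Bounding the start of the facet by `Fin 3` makes the claim decidable over all subsets.
      have : ∀ F : Finset (Fin 4),
          ¬ ((0 ∈ F ∧ 2 ∈ F) ∨ (0 ∈ F ∧ 3 ∈ F) ∨ (1 ∈ F ∧ 3 ∈ F)) →
          ∃ i : Fin 3, ∀ v ∈ F, (v : ℕ) = i ∨ (v : ℕ) = i + 1 := by decide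
      obtain ⟨i, hi⟩ := this F hcon
      exact hnF ((hmem F).2 ⟨hF, i, hi⟩)
    rcases hdec with ⟨h1, h2⟩ | ⟨h1, h2⟩ | ⟨h1, h2⟩
    · exact key _ _ (by decide) (Ideal.subset_span (by simp)) h1 h2
    · exact key _ _ (by decide) (Ideal.subset_span (by simp)) h1 h2
    · exact key _ _ (by decide) (Ideal.subset_span (by simp)) h1 h2

end PathRing

end

theorem mainTheorem7 (K : Type u) [Field K] (I : Ideal (MvPolynomial (Fin 4) K))
    (hI : I = Ideal.span {MvPolynomial.X 0 * MvPolynomial.X 2, MvPolynomial.X 0 * MvPolynomial.X 3,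
      MvPolynomial.X 1 * MvPolynomial.X 3}) :
    I = stanleyReisnerIdeal K (pathComplex 4) ∧
    IsBuchsbaumQuotient (I ^ 2) ∧
    ¬ IsCohenMacaulayRing (MvPolynomial (Fin 4) K ⧸ I ^ 2) ∧
    ringKrullDim (MvPolynomial (Fin 4) K ⧸ I ^ 2) = 2 ∧
    moduleDepth (irrelevantIdeal K 4) (MvPolynomial (Fin 4) K ⧸ I ^ 2) = 1 ∧
    Nonempty (((localCohomology (irrelevantIdeal K 4) 1).obj
        (ModuleCat.of (MvPolynomial (Fin 4) K) (MvPolynomial (Fin 4) K ⧸ I ^ 2)))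
      ≃ₗ[MvPolynomial (Fin 4) K] (MvPolynomial (Fin 4) K ⧸ irrelevantIdeal K 4)) ∧
    Module.finrank K (localCohomologySpace (I ^ 2) 1) = 1 ∧
    localCohomologyDegree (I ^ 2) 1 ![1, 0, 0, 1] = ⊤ ∧
    ∀ a : Fin 4 → ℤ, a ≠ ![1, 0, 0, 1] → localCohomologyDegree (I ^ 2) 1 a = ⊥ := by
  obtain rfl : I = pathIdeal K := hI
  exact ⟨pathIdeal_eq_stanleyReisnerIdeal, isBuchsbaumQuotient_pathIdeal_sq,
    not_isCohenMacaulayRing_pathRing, ringKrullDim_pathRing, moduleDepth_pathRing,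
    nonempty_localCohomology_equiv K, finrank_localCohomologySpace K,
    localCohomologyDegree_ends K, fun _ ha => localCohomologyDegree_eq_bot ha⟩
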